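/- All graphs are finite and may have parallel edges but no loops. For a graph $G$ and $X\subseteq V(G)$, let $\partial(X)$ be the set of edges with exactly one end in $X$. A graph $G$ is $5$-edge-connected if $|\partial(X)|\ge 5$ for every non-empty proper subset $X\subset V(G)$. A $5$-graph is a $5$-regular graph in which $|\partial(X)|\ge 5$ for every $X\subseteq V(G)$ of odd cardinality. A $5$-regular graph is class $2$ if it does not have $5$ pairwise disjoint perfect matchings. Theorem. Let $G$ be a $5$-edge-connected class $2$ $5$-graph such that the order $|V(G)|$ is smallest possible among all $5$-edge-connected class $2$ $5$-graphs. Then the following statements hold. (i) Every $5$-edge-cut of $G$ is trivial, i.e. if $X\subset V(G)$ and $|\partial(X)|=5$, then $|X|=1$ or $|V(G)\setminus X|=1$. (ii) Every $3$-vertex-cut of $G$ is trivial, i.e. if $X\subset V(G)$, $|X|=3$ and $G-X$ is not connected, then some component of $G-X$ consists of a single vertex. -/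

import Mathlib

open scoped Graph

universe u v

namespace Graph

/-- The degree of a vertex: the number of edges incident with it.
It is only used for finite graphs without loops. -/
noncomputable def degree {α : Type u} {β : Type v} (G : Graph α β) (x : α) : ℕ :=
  (G.incidenceSet x).ncard

/-- Every vertex has degree `r`. -/
def IsRegular {α : Type u} {β : Type v} (G : Graph α β) (r : ℕ) : Prop :=
  ∀ x ∈ V(G), G.degree x = r

/-- The edge-cut `∂(X)`: the edges with one end in `X` and the other end in `V(G) \ X`. -/
def edgeCut {α : Type u} {β : Type v} (G : Graph α β) (X : Set α) : Set β :=
  {e | ∃ x ∈ X, ∃ y ∈ V(G) \ X, G.IsLink e x y}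

/-- `|∂(X)| ≥ k` for every non-empty proper subset `X` of the vertex set. -/
def IsEdgeConnected {α : Type u} {β : Type v} (G : Graph α β) (k : ℕ) : Prop :=
  ∀ X : Set α, X ⊂ V(G) → X.Nonempty → k ≤ (G.edgeCut X).ncard

/-- An `r`-graph: a finite loopless `r`-regular (multi)graph in which every odd set of vertices
is connected by at least `r` edges to its complement. -/
structure IsRGraph {α : Type u} {β : Type v} (G : Graph α β) (r : ℕ) : Prop where
  finite_vertexSet : V(G).Finite
  finite_edgeSet : E(G).Finite
  loopless : G.Loopless
  regular : G.IsRegular r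
  odd_cut : ∀ X : Set α, X ⊆ V(G) → Odd X.ncard → r ≤ (G.edgeCut X).ncard

/-- A perfect matching: a set of edges such that each vertex is incident with exactly one of them,
i.e. the edge set of a `1`-factor. -/
def IsPerfectMatching {α : Type u} {β : Type v} (G : Graph α β) (M : Set β) : Prop :=
  M ⊆ E(G) ∧ ∀ x ∈ V(G), ∃! e, e ∈ M ∧ G.Inc e x

/-- `G` has `k` pairwise disjoint perfect matchings. (If `G` has a vertex, perfect matchings are
non-empty, so that disjoint ones are distinct.) -/
def HasPDPM {α : Type u} {β : Type v} (G : Graph α β) (k : ℕ) : Prop :=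
  ∃ N : Fin k → Set β, (∀ i, G.IsPerfectMatching (N i)) ∧ ∀ i j, i ≠ j → Disjoint (N i) (N j)

/-- An `r`-regular graph is class 2 if it does not have `r` pairwise disjoint perfect matchings. -/
def IsClassTwo {α : Type u} {β : Type v} (G : Graph α β) (r : ℕ) : Prop :=
  G.IsRegular r ∧ ¬ G.HasPDPM r

end Graph

/-!
A loopless multigraph is replaced by its multiplicity function `w`, where `w x y` is the number of
edges between `x` and `y`. Having five disjoint perfect matchings then means that `w` is a sum of
five perfect matchings, each encoded by the involution exchanging matched vertices
(`IsMatchingSum`). Cuts are double sums of `w`, and the smaller graphs below are written down as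
modified multiplicity functions. A smallest class 2 graph gives an `IsMinimalCounterexample`.

*Cuts of size five.* If a 5-edge-cut `∂(X)` is not trivial, then contracting either of its sides
yields a smaller 5-edge-connected 5-regular graph. Both have decompositions into perfect matchings,
each matching contains exactly one edge of the cut, and so the two decompositions can be
glued along the five cut edges (`isMatchingSum_of_contractCompl`).

*Three-vertex-cuts.* Suppose that `p`, `q`, `r` separate the non-empty sets `A` and `B`, where `|A|`
is odd and at least three. Then `|B|` is even. By parity, and because 5-edge-cuts are trivial, `A`
has `5 + 2L` outgoing edges with `L = 1` or `L = 2`, and `B` has six or eight. Two smaller graphs are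
formed.
* `B` is deleted, and edges between `p`, `q`, `r` are added which restore the degrees. Their numbers
  are determined by the degrees, and the graph is 5-edge-connected
  (`isFiveConnected_addTriangle`).
* `A` is contracted to a vertex `a`, and `L` pairs of edges at `a` are lifted to edges between
  `p`, `q`, `r`. This preserves 5-edge-connectivity if no cut of size at most six separates
  the two ends of a lifted edge from `A` and the third vertex
  (`isFiveConnected_addTriangleStar`). Uncrossing such small cuts shows that suitable pairs
  exist (`exists_lifting`).

Both graphs decompose into perfect matchings by minimality. In the second graph `a` is matched to one
of `p`, `q`, `r`, and the two others are either both matched into `B` or matched to each other; in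
the first graph either one or all three of `p`, `q`, `r` are matched into `A`. How often each pattern
occurs is determined by the multiplicities, so that the matchings of the two graphs can be paired and
glued to a decomposition of the whole graph (`isMatchingSum_of_sides`).
-/

open Finset

/-! ### Multiplicity functions, cuts and sums of perfect matchings -/

section Weights

variable {V : Type*}

/-- The number of edges from `Y` to `Z` in the multigraph with multiplicity function `w`. -/
def edgesBetween (w : V → V → ℕ) (Y Z : Finset V) : ℕ := ∑ x ∈ Y, ∑ y ∈ Z, w x y

theorem edgesBetween_comm {w : V → V → ℕ} (hw : ∀ x y, w x y = w y x) (Y Z : Finset V) :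
    edgesBetween w Y Z = edgesBetween w Z Y := by
  unfold edgesBetween
  rw [sum_comm]
  simp_rw [hw]

theorem edgesBetween_eq_zero {w : V → V → ℕ} {Y Z : Finset V}
    (h : ∀ x ∈ Y, ∀ y ∈ Z, w x y = 0) : edgesBetween w Y Z = 0 :=
  sum_eq_zero fun x hx => sum_eq_zero fun y hy => h x hx y hy

theorem edgesBetween_congr {w w' : V → V → ℕ} {Y Z : Finset V}
    (h : ∀ x ∈ Y, ∀ y ∈ Z, w x y = w' x y) : edgesBetween w Y Z = edgesBetween w' Y Z :=
  sum_congr rfl fun x hx => sum_congr rfl fun y hy => h x hx y hy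

theorem edgesBetween_add (w w' : V → V → ℕ) (Y Z : Finset V) :
    edgesBetween (fun x y => w x y + w' x y) Y Z = edgesBetween w Y Z + edgesBetween w' Y Z := by
  simp [edgesBetween, sum_add_distrib]

theorem even_edgesBetween_self {w : V → V → ℕ} (hw : ∀ x y, w x y = w y x)
    (h0 : ∀ x, w x x = 0) (Y : Finset V) : Even (edgesBetween w Y Y) := by
  -- Modulo two, the terms for `(x, y)` and `(y, x)` cancel.
  rw [← ZMod.natCast_eq_zero_iff_even]
  unfold edgesBetween
  rw [← sum_product', Nat.cast_sum]
  refine sum_involution (fun x _ => (x.2, x.1)) ?_ ?_ ?_ ?_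
  · intro x _
    rw [hw x.2 x.1, ← two_mul]
    exact mul_eq_zero_of_left rfl _
  · rintro ⟨x, y⟩ _ hne heq
    simp only [Prod.mk.injEq] at heq
    simp [heq.1, h0] at hne
  · rintro ⟨x, y⟩ h
    simpa [and_comm] using h
  · rintro ⟨x, y⟩ _
    rfl

variable [DecidableEq V]

/-- The multiplicity function `w` defines on the vertex set `S` a loopless `5`-regular multigraph
all of whose proper non-empty cuts have at least five edges. -/
structure IsFiveConnected (w : V → V → ℕ) (S : Finset V) : Prop where
  symm : ∀ x y, w x y = w y x
  loopless : ∀ x, w x x = 0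
  regular : ∀ x ∈ S, ∑ y ∈ S, w x y = 5
  conn : ∀ Y ⊆ S, Y.Nonempty → Y ≠ S → 5 ≤ edgesBetween w Y (S \ Y)

/-- The multigraph with multiplicity function `w` on `S` is the sum of `|κ|` perfect matchings.
A perfect matching is encoded by the involution that exchanges the ends of each of its edges. -/
def IsMatchingSum (κ : Type*) [Fintype κ] (w : V → V → ℕ) (S : Finset V) : Prop :=
  ∃ f : κ → V → V, (∀ i, ∀ x ∈ S, f i x ∈ S ∧ f i (f i x) = x) ∧
    ∀ x ∈ S, ∀ y ∈ S, #{i | f i x = y} = w x y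

/-- `m` parallel edges between `p` and `q`. -/
def parallelEdges (p q : V) (m : ℕ) (x y : V) : ℕ :=
  (if x = p then if y = q then m else 0 else 0) + (if x = q then if y = p then m else 0 else 0)

theorem parallelEdges_symm (p q : V) (m : ℕ) (x y : V) :
    parallelEdges p q m x y = parallelEdges p q m y x := by
  unfold parallelEdges; split_ifs <;> omega

theorem sum_parallelEdges (p q : V) (m : ℕ) (x : V) (Z : Finset V) :
    ∑ y ∈ Z, parallelEdges p q m x y =
      (if x = p ∧ q ∈ Z then m else 0) + (if x = q ∧ p ∈ Z then m else 0) := by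
  unfold parallelEdges
  rw [sum_add_distrib]
  congr 1 <;> split_ifs with h1 h2 h2 <;> simp_all

theorem edgesBetween_parallelEdges (p q : V) (m : ℕ) (Y Z : Finset V) :
    edgesBetween (parallelEdges p q m) Y Z =
      (if p ∈ Y ∧ q ∈ Z then m else 0) + (if q ∈ Y ∧ p ∈ Z then m else 0) := by
  unfold edgesBetween
  simp_rw [sum_parallelEdges]
  rw [sum_add_distrib]
  congr 1
  · by_cases h : q ∈ Z <;> simp [h]
  · by_cases h : p ∈ Z <;> simp [h]

theorem edgesBetween_union_right {w : V → V → ℕ} {Z Z' : Finset V} (h : Disjoint Z Z')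
    (Y : Finset V) : edgesBetween w Y (Z ∪ Z') = edgesBetween w Y Z + edgesBetween w Y Z' := by
  unfold edgesBetween
  rw [← sum_add_distrib]
  exact sum_congr rfl fun _ _ => sum_union h

/-- It suffices to check the cut condition for one of each two complementary sets. -/
theorem conn_of_compl {w : V → V → ℕ} (hw : ∀ x y, w x y = w y x) {S : Finset V}
    {P : Finset V → Prop} (hP : ∀ Y ⊆ S, P Y ∨ P (S \ Y))
    (h : ∀ Y ⊆ S, P Y → Y.Nonempty → Y ≠ S → 5 ≤ edgesBetween w Y (S \ Y)) (Y : Finset V)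
    (hYS : Y ⊆ S) (hY : Y.Nonempty) (hne : Y ≠ S) : 5 ≤ edgesBetween w Y (S \ Y) := by
  rcases hP Y hYS with h1 | h1
  · exact h Y hYS h1 hY hne
  · have := h (S \ Y) sdiff_subset h1 (sdiff_nonempty.2 fun h => hne (hYS.antisymm h))
      fun h => by
        obtain ⟨y, hy⟩ := hY
        have := hYS hy
        rw [← h] at this
        exact (mem_sdiff.1 this).2 hy
    rwa [Finset.sdiff_sdiff_eq_self hYS, edgesBetween_comm hw] at this

/-- In a `5`-regular multigraph the size of a cut has the parity of either side. -/
theorem IsFiveConnected.even_card_add {w : V → V → ℕ} {S : Finset V} (h : IsFiveConnected w S)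
    {Y : Finset V} (hY : Y ⊆ S) : Even (#Y + edgesBetween w Y (S \ Y)) := by
  have h1 : edgesBetween w Y S = #Y * 5 := by
    unfold edgesBetween
    rw [sum_congr rfl fun x hx => h.regular x (hY hx)]
    simp
  have h2 : edgesBetween w Y S = edgesBetween w Y Y + edgesBetween w Y (S \ Y) := by
    rw [← edgesBetween_union_right disjoint_sdiff, union_sdiff_of_subset hY]
  have := even_edgesBetween_self h.symm h.loopless Y
  grind

/-- The whole vertex set has an empty cut. -/
theorem IsFiveConnected.even_card {w : V → V → ℕ} {S : Finset V} (h : IsFiveConnected w S) :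
    Even #S := by
  have := h.even_card_add subset_rfl
  rwa [edgesBetween_eq_zero (by simp), add_zero] at this

theorem IsFiveConnected.congr {w w' : V → V → ℕ} {S : Finset V} (h : IsFiveConnected w S)
    (hsymm : ∀ x y, w' x y = w' y x) (h0 : ∀ x, w' x x = 0)
    (hw : ∀ x ∈ S, ∀ y ∈ S, w' x y = w x y) : IsFiveConnected w' S where
  symm := hsymm
  loopless := h0
  regular x hx := by rw [sum_congr rfl (hw x hx), h.regular x hx]
  conn Y hYS hY hne := by
    rw [edgesBetween_congr fun x hx y hy => hw x (hYS hx) y (mem_sdiff.1 hy).1]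
    exact h.conn Y hYS hY hne

theorem IsMatchingSum.congr {κ : Type*} [Fintype κ] {w w' : V → V → ℕ} {S : Finset V}
    (h : IsMatchingSum κ w S) (hw : ∀ x ∈ S, ∀ y ∈ S, w x y = w' x y) :
    IsMatchingSum κ w' S := by
  obtain ⟨f, hf, hc⟩ := h
  exact ⟨f, hf, fun x hx y hy => by rw [hc x hx y hy, hw x hx y hy]⟩

/-- The cut function is submodular. -/
theorem edgesBetween_submodular [Fintype V] (w : V → V → ℕ) (Y Z : Finset V) :
    edgesBetween w (Y ∩ Z) (Y ∩ Z)ᶜ + edgesBetween w (Y ∪ Z) (Y ∪ Z)ᶜ ≤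
      edgesBetween w Y Yᶜ + edgesBetween w Z Zᶜ := by
  have key : ∀ T : Finset V, edgesBetween w T Tᶜ =
      ∑ x, ∑ y, if x ∈ T then if y ∈ T then 0 else w x y else 0 := by
    intro T
    unfold edgesBetween
    rw [← sum_filter_add_sum_filter_not univ (· ∈ T) (fun x => ∑ y, _)]
    rw [sum_eq_zero (s := univ.filter (· ∉ T)), add_zero]
    · refine sum_congr (by ext; simp) fun x hx => ?_
      rw [← sum_filter_add_sum_filter_not univ (· ∉ T) (fun y => ite _ _ _)]
      rw [sum_eq_zero (s := univ.filter (¬ · ∉ T)), add_zero]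
      · refine sum_congr (by ext; simp) fun y hy => ?_
        simp_all
      · intro y hy; simp_all
    · intro x hx; simp_all
  simp only [key, ← sum_add_distrib]
  refine sum_le_sum fun x _ => sum_le_sum fun y _ => ?_
  by_cases h1 : x ∈ Y <;> by_cases h2 : x ∈ Z <;> by_cases h3 : y ∈ Y <;> by_cases h4 : y ∈ Z <;>
    simp [h1, h2, h3, h4]

theorem IsMatchingSum.congr_index {κ κ' : Type*} [Fintype κ] [Fintype κ'] (e : κ' ≃ κ)
    {w : V → V → ℕ} {S : Finset V} (h : IsMatchingSum κ w S) : IsMatchingSum κ' w S := by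
  obtain ⟨f, hf, hc⟩ := h
  refine ⟨fun i => f (e i), fun i => hf (e i), fun x hx y hy => ?_⟩
  rw [← hc x hx y hy]
  exact card_bij (fun i _ => e i) (by simp) (by simp) fun i hi => ⟨e.symm i, by simpa using hi⟩

end Weights

/-! ### Cuts of size five -/

section Contraction

variable {V : Type*} [DecidableEq V] [Fintype V]

/-- The multiplicities after `Xᶜ` is contracted to the single vertex `a ∉ X`. -/
def contractCompl (w : V → V → ℕ) (X : Finset V) (a : V) (x y : V) : ℕ :=
  if x ∈ X then if y ∈ X then w x y else if y = a then ∑ z ∈ Xᶜ, w x z else 0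
  else if x = a ∧ y ∈ X then ∑ z ∈ Xᶜ, w y z else 0

theorem isFiveConnected_contractCompl {w : V → V → ℕ} (hw : IsFiveConnected w univ)
    {X : Finset V} (hX : edgesBetween w X Xᶜ = 5) {a : V} (ha : a ∉ X) :
    IsFiveConnected (contractCompl w X a) (insert a X) := by
  have hsymm : ∀ x y, contractCompl w X a x y = contractCompl w X a y x := by
    intro x y
    have := hw.symm x y
    unfold contractCompl
    by_cases h1 : x ∈ X <;> by_cases h2 : y ∈ X <;> simp [h1, h2, this]
  have hrow : ∀ x ∈ X, ∑ y ∈ X, contractCompl w X a x y = ∑ y ∈ X, w x y := fun x hx =>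
    sum_congr rfl fun y hy => by simp [contractCompl, hx, hy]
  have hra : ∀ x ∈ X, contractCompl w X a x a = ∑ z ∈ Xᶜ, w x z := fun x hx => by
    simp [contractCompl, hx, ha]
  refine ⟨hsymm, ?_, ?_, ?_⟩
  · intro x
    unfold contractCompl
    by_cases h1 : x ∈ X <;> simp [h1, hw.loopless]
  · intro x hx
    rw [sum_insert ha]
    rcases mem_insert.1 hx with rfl | hx
    · rw [← hX, hsymm]
      simp only [contractCompl, ha, if_false, and_false]
      rw [zero_add]
      exact sum_congr rfl fun y hy => by simp [hy]
    · rw [hrow x hx, hra x hx, add_comm, sum_add_sum_compl]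
      exact hw.regular x (mem_univ x)
  · refine conn_of_compl hsymm (P := fun Y => a ∉ Y) (fun Y _ => ?_) fun Y hYS haY hY _ => ?_
    · by_cases h : a ∈ Y <;> simp [h]
    · have hYX : Y ⊆ X := fun y hy => (mem_insert.1 (hYS hy)).resolve_left fun h => haY (h ▸ hy)
      have hne : Y ≠ univ := fun h => haY (h ▸ mem_univ a)
      refine (hw.conn Y (subset_univ _) hY hne).trans_eq ?_
      refine sum_congr rfl fun x hx => ?_
      have h1 : (univ \ Y : Finset V) = (X \ Y) ∪ Xᶜ := by
        ext z; have := @hYX z; simp; tauto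
      have h2 : insert a X \ Y = insert a (X \ Y) := insert_sdiff_of_notMem _ haY
      rw [h1, h2, sum_insert (by simp [ha]), hra x (hYX hx), add_comm, sum_union]
      · congr 1
        exact sum_congr rfl fun y hy => by
          simp [contractCompl, hYX hx, (mem_sdiff.1 hy).1]
      · exact disjoint_left.2 fun z hz hz' => by simp at hz hz'; tauto

/-- Two families with equally large fibres agree up to reindexing. -/
theorem exists_equiv_of_card_fiber_eq {ι κ T : Type*} [Fintype ι] [Fintype κ] [DecidableEq T]
    (s : ι → T) (t : κ → T) (h : ∀ z, #{i | s i = z} = #{j | t j = z}) :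
    ∃ e : ι ≃ κ, ∀ i, t (e i) = s i := by
  have h' : ∀ z, Nonempty ({i // s i = z} ≃ {j // t j = z}) := fun z =>
    ⟨Fintype.equivOfCardEq (by rw [Fintype.card_subtype, Fintype.card_subtype, h z])⟩
  let e := fun z => (h' z).some
  exact ⟨Equiv.ofFiberEquiv e, fun i => Equiv.ofFiberEquiv_map e i⟩

/-- A decomposition of the contraction, read off on the uncontracted side `X`: if `u k` lists the
ends in `X` of the cut edges, each `u k` can be exempted from one matching of `X`. -/
theorem exists_matchings_of_contractCompl {w : V → V → ℕ} {X : Finset V} {a : V} (ha : a ∉ X)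
    (h : IsMatchingSum (Fin 5) (contractCompl w X a) (insert a X)) {κ : Type*} [Fintype κ]
    (u : κ → V) (huX : ∀ k, u k ∈ X) (hu : ∀ x ∈ X, #{k | u k = x} = ∑ z ∈ Xᶜ, w x z) :
    ∃ f : κ → V → V,
      (∀ k, ∀ x ∈ X, x ≠ u k → f k x ∈ X ∧ f k (f k x) = x ∧ f k x ≠ u k) ∧
      ∀ x ∈ X, ∀ y ∈ X, #{k | x ≠ u k ∧ f k x = y} = w x y := by
  obtain ⟨f, hf, hc⟩ := h
  have haS := mem_insert_self a X
  have hfa : ∀ i, f i a ∈ X := by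
    intro i
    rcases mem_insert.1 (hf i a haS).1 with h | h
    · have := hc a haS a haS
      simp only [contractCompl, ha, if_false, and_false, card_eq_zero] at this
      exact absurd h (filter_eq_empty_iff.1 this (mem_univ i))
    · exact h
  obtain ⟨e, he⟩ := exists_equiv_of_card_fiber_eq u (fun i => f i a) fun x => by
    by_cases hx : x ∈ X
    · rw [hu x hx, hc a haS x (mem_insert_of_mem hx)]
      simp [contractCompl, ha, hx]
    · have h1 : ∀ k, u k ≠ x := fun k hk => hx (hk ▸ huX k)
      have h2 : ∀ i, f i a ≠ x := fun i hi => hx (hi ▸ hfa i)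
      simp [h1, h2]
  have hne : ∀ k, ∀ x ∈ X, x = u k ↔ f (e k) x = a := by
    intro k x hx
    constructor
    · rintro rfl
      rw [← he k]
      exact (hf _ a haS).2
    · intro h
      rw [← he k, ← h]
      exact (hf _ x (mem_insert_of_mem hx)).2.symm
  refine ⟨fun k => f (e k), fun k x hx hxu => ?_, fun x hx y hy => ?_⟩
  · obtain ⟨h1, h2⟩ := hf (e k) x (mem_insert_of_mem hx)
    have h3 : f (e k) x ∈ X := (mem_insert.1 h1).resolve_left fun h => hxu ((hne k x hx).2 h)
    refine ⟨h3, h2, fun h => ?_⟩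
    rw [(hne k _ h3).1 h] at h2
    exact ha (h2 ▸ hx)
  · have := hc x (mem_insert_of_mem hx) y (mem_insert_of_mem hy)
    simp only [contractCompl, hx, hy, if_true] at this
    rw [← this]
    refine card_bij (fun k _ => e k) (by simp) (by simp) fun i hi => ⟨e.symm i, ?_, by simp⟩
    simp only [mem_filter, mem_univ, true_and] at hi ⊢
    rw [ne_eq, hne _ x hx]
    simp only [Equiv.apply_symm_apply, hi, and_true]
    rintro rfl
    exact ha hy

/-- Decompositions of the two contractions along a cut of size five fit together: the matchings on
both sides are indexed by the cut edges. -/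
theorem isMatchingSum_of_contractCompl {w : V → V → ℕ} (hw : IsFiveConnected w univ)
    {X : Finset V} (hX : edgesBetween w X Xᶜ = 5) {a b : V} (ha : a ∉ X) (hb : b ∉ Xᶜ)
    (h : IsMatchingSum (Fin 5) (contractCompl w X a) (insert a X))
    (h' : IsMatchingSum (Fin 5) (contractCompl w Xᶜ b) (insert b Xᶜ)) :
    IsMatchingSum (Fin 5) w univ := by
  -- The type of cut edges.
  let T := Σ p : ↥(X ×ˢ Xᶜ), Fin (w p.1.1 p.1.2)
  have hcard : ∀ (P : V × V → Prop) [DecidablePred P],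
      #{τ : T | P τ.1.1} = ∑ x ∈ X, ∑ y ∈ Xᶜ, if P (x, y) then w x y else 0 := by
    intro P _
    rw [card_filter, Fintype.sum_sigma,
      ← sum_product' X Xᶜ (fun x y => if P (x, y) then w x y else 0),
      ← sum_coe_sort (X ×ˢ Xᶜ) (fun p => if P (p.1, p.2) then w p.1 p.2 else 0)]
    refine sum_congr rfl fun p _ => ?_
    by_cases hp : P p <;> simp [hp]
  have hT : Fintype.card T = Fintype.card (Fin 5) := by
    have := hcard (fun _ => True)
    simpa [← hX, edgesBetween] using this
  let u : T → V := fun τ => τ.1.1.1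
  let v : T → V := fun τ => τ.1.1.2
  have huX : ∀ τ, u τ ∈ X := fun τ => (mem_product.1 τ.1.2).1
  have hvX : ∀ τ, v τ ∈ Xᶜ := fun τ => (mem_product.1 τ.1.2).2
  have hvX' : ∀ τ, v τ ∉ X := fun τ => mem_compl.1 (hvX τ)
  obtain ⟨f, hf, hfc⟩ := exists_matchings_of_contractCompl ha h u huX fun x hx => by
    rw [hcard (fun p => p.1 = x), sum_eq_single_of_mem x hx]
    · simp
    · intro y _ hy
      simp [hy]
  obtain ⟨g, hg, hgc⟩ := exists_matchings_of_contractCompl hb h' v hvX fun y hy => by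
    rw [hcard (fun p => p.2 = y), compl_compl]
    refine sum_congr rfl fun x hx => ?_
    rw [sum_ite_eq' Xᶜ y, if_pos hy, hw.symm]
  have huv : ∀ x ∈ X, ∀ y ∉ X, #{τ | x = u τ ∧ v τ = y} = w x y := by
    intro x hx y hy
    rw [hcard (fun p => x = p.1 ∧ p.2 = y), sum_eq_single_of_mem x hx,
      sum_eq_single_of_mem y (mem_compl.2 hy)]
    · simp
    · intro z _ hz
      simp [hz]
    · intro z _ hz
      simp [hz.symm]
  refine IsMatchingSum.congr_index (Fintype.equivOfCardEq hT).symm ⟨fun τ x =>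
    if x ∈ X then if x = u τ then v τ else f τ x else if x = v τ then u τ else g τ x, ?_, ?_⟩
  · intro τ x _
    refine ⟨mem_univ _, ?_⟩
    by_cases hx : x ∈ X
    · by_cases hxu : x = u τ
      · subst hxu
        simp [huX, hvX']
      · obtain ⟨h1, h2, h3⟩ := hf τ x hx hxu
        simp [hx, hxu, h1, h2, h3]
    · by_cases hxv : x = v τ
      · subst hxv
        simp [huX, hvX']
      · obtain ⟨h1, h2, h3⟩ := hg τ x (mem_compl.2 hx) hxv
        simp [hx, hxv, mem_compl.1 h1, h2, h3]
  · intro x _ y _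
    by_cases hx : x ∈ X <;> by_cases hy : y ∈ X
    · rw [← hfc x hx y hy]
      congr 1
      ext τ
      simp only [hx, if_true, mem_filter, mem_univ, true_and]
      by_cases hxu : x = u τ
      · simp only [hxu, if_true, ne_eq, not_true, false_and, iff_false]
        exact fun h => hvX' τ (h ▸ hy)
      · simp [hxu]
    · rw [← huv x hx y hy]
      congr 1
      ext τ
      simp only [hx, if_true, mem_filter, mem_univ, true_and]
      by_cases hxu : x = u τ
      · simp [hxu]
      · simp only [hxu, if_false, false_and, iff_false]
        exact fun h => hy (h ▸ (hf τ x hx hxu).1)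
    · rw [hw.symm, ← huv y hy x hx]
      congr 1
      ext τ
      simp only [hx, if_false, mem_filter, mem_univ, true_and]
      by_cases hxv : x = v τ
      · simp [← hxv, eq_comm]
      · simp only [hxv, if_false, Ne.symm hxv, and_false, iff_false]
        exact fun h => mem_compl.1 (hg τ x (mem_compl.2 hx) hxv).1 (h ▸ hy)
    · rw [← hgc x (mem_compl.2 hx) y (mem_compl.2 hy)]
      congr 1
      ext τ
      simp only [hx, if_false, mem_filter, mem_univ, true_and]
      by_cases hxv : x = v τ
      · simp only [hxv, if_true, ne_eq, not_true, false_and, iff_false]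
        exact fun h => hy (h ▸ huX τ)
      · simp [hxv]

/-- `w` is a `5`-edge-connected `5`-regular multigraph on `V` which has no decomposition into
perfect matchings, while all smaller ones do. -/
structure IsMinimalCounterexample (w : V → V → ℕ) : Prop where
  fiveConnected : IsFiveConnected w univ
  not_isMatchingSum : ¬ IsMatchingSum (Fin 5) w univ
  minimal : ∀ (w' : V → V → ℕ) (S : Finset V), IsFiveConnected w' S → #S < Fintype.card V →
    IsMatchingSum (Fin 5) w' S

theorem IsMinimalCounterexample.card_eq_one_of_cut_eq_five {w : V → V → ℕ}
    (hw : IsMinimalCounterexample w) {X : Finset V} (hX : edgesBetween w X Xᶜ = 5) :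
    #X = 1 ∨ #Xᶜ = 1 := by
  by_contra! hne
  have hX0 : X.Nonempty := by
    rw [nonempty_iff_ne_empty]
    rintro rfl
    simp [edgesBetween] at hX
  have hX1 : Xᶜ.Nonempty := by
    rw [nonempty_iff_ne_empty]
    intro h
    simp [h, edgesBetween] at hX
  have hcard := card_add_card_compl X
  have h0 := hX0.card_pos
  have h1 := hX1.card_pos
  obtain ⟨b, hb⟩ := hX0
  obtain ⟨a, ha⟩ := hX1
  rw [mem_compl] at ha
  have hb' : b ∉ Xᶜ := by simpa using hb
  have hX' : edgesBetween w Xᶜ Xᶜᶜ = 5 := by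
    rw [compl_compl, edgesBetween_comm hw.fiveConnected.symm, hX]
  refine hw.not_isMatchingSum (isMatchingSum_of_contractCompl hw.fiveConnected hX ha hb' ?_ ?_)
  · exact hw.minimal _ _ (isFiveConnected_contractCompl hw.fiveConnected hX ha)
      (by rw [card_insert_of_notMem ha]; omega)
  · exact hw.minimal _ _ (isFiveConnected_contractCompl hw.fiveConnected hX' hb')
      (by rw [card_insert_of_notMem hb']; omega)

end Contraction

/-! ### Smaller graphs from a three-vertex-cut -/

section ThreeCut

variable {V : Type*}

/-- The vertices `p`, `q`, `r` separate `A` from `B` in the multigraph with multiplicities `w`. -/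
structure IsThreeCut (w : V → V → ℕ) (A B : Finset V) (p q r : V) : Prop where
  pq : p ≠ q
  pr : p ≠ r
  qr : q ≠ r
  disj : Disjoint A B
  pA : p ∉ A
  qA : q ∉ A
  rA : r ∉ A
  pB : p ∉ B
  qB : q ∉ B
  rB : r ∉ B
  cover : ∀ x, x ∉ A → x ∉ B → x = p ∨ x = q ∨ x = r
  noEdge : ∀ x ∈ A, ∀ y ∈ B, w x y = 0

namespace IsThreeCut

variable {w : V → V → ℕ} {A B : Finset V} {p q r : V}

theorem swap_sides (h : IsThreeCut w A B p q r) (hw : ∀ x y, w x y = w y x) :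
    IsThreeCut w B A p q r :=
  ⟨h.pq, h.pr, h.qr, h.disj.symm, h.pB, h.qB, h.rB, h.pA, h.qA, h.rA,
    fun x h1 h2 => h.cover x h2 h1, fun x hx y hy => by rw [hw, h.noEdge y hy x hx]⟩

theorem swap_left (h : IsThreeCut w A B p q r) : IsThreeCut w A B q p r :=
  ⟨h.pq.symm, h.qr, h.pr, h.disj, h.qA, h.pA, h.rA, h.qB, h.pB, h.rB,
    fun x h1 h2 => by have := h.cover x h1 h2; tauto, h.noEdge⟩

theorem swap_right (h : IsThreeCut w A B p q r) : IsThreeCut w A B p r q :=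
  ⟨h.pr, h.pq, h.qr.symm, h.disj, h.pA, h.rA, h.qA, h.pB, h.rB, h.qB,
    fun x h1 h2 => by have := h.cover x h1 h2; tauto, h.noEdge⟩

variable [DecidableEq V]

theorem sum_eq_of_support (h : IsThreeCut w A B p q r) {Y : Finset V} {φ : V → ℕ}
    (hφ : ∀ x ∈ Y, x ≠ p → x ≠ q → x ≠ r → φ x = 0) :
    ∑ x ∈ Y, φ x = (if p ∈ Y then φ p else 0) + (if q ∈ Y then φ q else 0) +
      (if r ∈ Y then φ r else 0) := by
  have : ∀ x ∈ Y, φ x = (if x = p then φ p else 0) + (if x = q then φ q else 0) +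
      (if x = r then φ r else 0) := by
    intro x hx
    by_cases h1 : x = p
    · subst h1; simp [h.pq, h.pr]
    by_cases h2 : x = q
    · subst h2; simp [h.pq.symm, h.qr]
    by_cases h3 : x = r
    · subst h3; simp [h.pr.symm, h.qr.symm]
    simp [h1, h2, h3, hφ x hx h1 h2 h3]
  rw [sum_congr rfl this, sum_add_distrib, sum_add_distrib, sum_ite_eq', sum_ite_eq', sum_ite_eq']

theorem sum_row_eq_zero (h : IsThreeCut w A B p q r) (hw : ∀ x y, w x y = w y x) {x : V}
    (hx : x ∉ A) (hp : x ≠ p) (hq : x ≠ q) (hr : x ≠ r) : ∑ y ∈ A, w x y = 0 := by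
  have hxB : x ∈ B := by
    by_contra hB
    rcases h.cover x hx hB with h | h | h <;> contradiction
  exact sum_eq_zero fun y hy => by rw [hw, h.noEdge y hy x hxB]

variable [Fintype V]

theorem sum_compl_left (h : IsThreeCut w A B p q r) (φ : V → ℕ) :
    ∑ x ∈ Aᶜ, φ x = ∑ x ∈ B, φ x + φ p + φ q + φ r := by
  have : Aᶜ = insert p (insert q (insert r B)) := by
    ext x
    have h1 := h.cover x
    have h2 : x ∈ A → x ∉ B := fun h' => disjoint_left.1 h.disj h'
    have := h.pA
    have := h.qA
    have := h.rA
    simp only [mem_compl, mem_insert]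
    constructor
    · tauto
    · rintro (rfl | rfl | rfl | h3) <;> tauto
  rw [this, sum_insert (by simp [h.pq, h.pr, h.pB]), sum_insert (by simp [h.qr, h.qB]),
    sum_insert h.rB]
  ring

theorem sum_univ (h : IsThreeCut w A B p q r) (φ : V → ℕ) :
    ∑ x, φ x = ∑ x ∈ A, φ x + ∑ x ∈ B, φ x + φ p + φ q + φ r := by
  rw [← sum_add_sum_compl A, h.sum_compl_left]
  ring

/-- The cut of a set that avoids `A`, with the edges to `A` counted separately. -/
theorem cut_eq (h : IsThreeCut w A B p q r) (hw : ∀ x y, w x y = w y x) {Y : Finset V}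
    (hY : Y ⊆ Aᶜ) : edgesBetween w Y Yᶜ = edgesBetween w Y (Aᶜ \ Y) +
      ((if p ∈ Y then ∑ y ∈ A, w p y else 0) + (if q ∈ Y then ∑ y ∈ A, w q y else 0) +
      (if r ∈ Y then ∑ y ∈ A, w r y else 0)) := by
  have h1 : Yᶜ = (Aᶜ \ Y) ∪ A := by
    ext x
    have := @hY x
    simp only [mem_compl, mem_union, mem_sdiff] at *
    tauto
  rw [h1, edgesBetween_union_right]
  · congr 1
    exact h.sum_eq_of_support fun x hx => h.sum_row_eq_zero hw (mem_compl.1 (hY hx))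
  · exact disjoint_left.2 fun x hx hx' => mem_compl.1 (mem_sdiff.1 hx).1 hx'

theorem cut_left (h : IsThreeCut w A B p q r) (hw : ∀ x y, w x y = w y x) :
    edgesBetween w A Aᶜ = ∑ y ∈ A, w p y + ∑ y ∈ A, w q y + ∑ y ∈ A, w r y := by
  have := h.pA
  have := h.qA
  have := h.rA
  rw [edgesBetween_comm hw]
  refine (h.sum_eq_of_support fun x hx => h.sum_row_eq_zero hw (mem_compl.1 hx)).trans ?_
  simp [*]

theorem sum_row (h : IsThreeCut w A B p q r) (hw : IsFiveConnected w univ) :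
    ∑ y ∈ A, w p y + ∑ y ∈ B, w p y + w p q + w p r = 5 := by
  rw [← hw.regular p (mem_univ p), h.sum_univ (w p), hw.loopless p]
  ring

/-- The multigraph induced on one side together with the three separating vertices, which are
joined by additional edges: `np` between `q` and `r`, and so on. -/
def addTriangle (w : V → V → ℕ) (p q r : V) (np nq nr : ℕ) (x y : V) : ℕ :=
  w x y + (parallelEdges q r np x y + parallelEdges p r nq x y + parallelEdges p q nr x y)

/-- If the additional edges restore the degrees, then `5`-edge-connectivity is inherited: each cut
of the new multigraph has the size of a cut of the old one. -/
theorem isFiveConnected_addTriangle (h : IsThreeCut w A B p q r) (hw : IsFiveConnected w univ)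
    {np nq nr : ℕ} (hp : nq + nr = ∑ y ∈ B, w p y)
    (hq : np + nr = ∑ y ∈ B, w q y) (hr : np + nq = ∑ y ∈ B, w r y) :
    IsFiveConnected (addTriangle w p q r np nq nr) Bᶜ := by
  have hpq := h.pq
  have hpr := h.pr
  have hqr := h.qr
  have hpB := h.pB
  have hqB := h.qB
  have hrB := h.rB
  have h' := h.swap_sides hw.symm
  have hsymm : ∀ x y, addTriangle w p q r np nq nr x y = addTriangle w p q r np nq nr y x := by
    intro x y
    unfold addTriangle
    rw [hw.symm, parallelEdges_symm q r, parallelEdges_symm p r, parallelEdges_symm p q]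
  refine ⟨hsymm, ?_, ?_, ?_⟩
  · intro x
    simp only [addTriangle, hw.loopless, parallelEdges]
    by_cases h1 : x = p
    · subst h1; simp [hpq, hpr]
    by_cases h2 : x = q
    · subst h2; simp [h1, hqr]
    simp [h1, h2]
  · intro x hx
    have h5 := hw.regular x (mem_univ x)
    rw [← sum_add_sum_compl B] at h5
    simp only [addTriangle, sum_add_distrib, sum_parallelEdges]
    by_cases h1 : x = p
    · subst h1; simp [*]; omega
    by_cases h2 : x = q
    · subst h2; simp [*]; omega
    by_cases h3 : x = r
    · subst h3; simp [*]; omega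
    rw [h'.sum_row_eq_zero hw.symm (mem_compl.1 hx) h1 h2 h3] at h5
    simp [h1, h2, h3]
    omega
  · refine conn_of_compl hsymm
      (P := fun Y => (p ∉ Y ∨ q ∉ Y) ∧ (p ∉ Y ∨ r ∉ Y) ∧ (q ∉ Y ∨ r ∉ Y))
      (fun Y _ => ?_) fun Y hYS hP hY _ => ?_
    · simp only [mem_sdiff, mem_compl]
      tauto
    · have hne : Y ≠ univ := by
        rintro rfl
        simp at hP
      have h5 := hw.conn Y (subset_univ _) hY hne
      rw [← compl_eq_univ_sdiff, h'.cut_eq hw.symm hYS, ← hp, ← hq, ← hr] at h5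
      unfold addTriangle
      rw [edgesBetween_add, edgesBetween_add, edgesBetween_add, edgesBetween_parallelEdges,
        edgesBetween_parallelEdges, edgesBetween_parallelEdges]
      by_cases h1 : p ∈ Y <;> by_cases h2 : q ∈ Y <;> by_cases h3 : r ∈ Y <;>
        simp_all [mem_sdiff, mem_compl]

/-- The multigraph obtained by deleting `A` and joining the vertex `a ∈ A` to the separating
vertices by `dp`, `dq` and `dr` edges, with additional edges between the separating vertices:
`lp` between `q` and `r`, and so on. -/
def addTriangleStar (w : V → V → ℕ) (A : Finset V) (a p q r : V) (lp lq lr dp dq dr : ℕ)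
    (x y : V) : ℕ :=
  (if x ∈ A ∨ y ∈ A then 0 else w x y) +
    (parallelEdges q r lp x y + parallelEdges p r lq x y + parallelEdges p q lr x y) +
    (parallelEdges a p dp x y + parallelEdges a q dq x y + parallelEdges a r dr x y)

/-- Contracting `A` to `a` and lifting `lp` pairs of edges at `a` to edges `qr`, and so on, does
not destroy `5`-edge-connectivity, provided that the lifted cuts are large enough. -/
theorem isFiveConnected_addTriangleStar (h : IsThreeCut w A B p q r)
    (hw : IsFiveConnected w univ) {a : V} (ha : a ∈ A) {lp lq lr dp dq dr : ℕ}
    (hp : dp + lq + lr = ∑ y ∈ A, w p y) (hq : dq + lp + lr = ∑ y ∈ A, w q y)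
    (hr : dr + lp + lq = ∑ y ∈ A, w r y) (hd : dp + dq + dr = 5)
    (hlp : ∀ Y ⊆ Aᶜ, p ∉ Y → q ∈ Y → r ∈ Y → 5 + 2 * lp ≤ edgesBetween w Y Yᶜ)
    (hlq : ∀ Y ⊆ Aᶜ, p ∈ Y → q ∉ Y → r ∈ Y → 5 + 2 * lq ≤ edgesBetween w Y Yᶜ)
    (hlr : ∀ Y ⊆ Aᶜ, p ∈ Y → q ∈ Y → r ∉ Y → 5 + 2 * lr ≤ edgesBetween w Y Yᶜ) :
    IsFiveConnected (addTriangleStar w A a p q r lp lq lr dp dq dr) (insert a Aᶜ) := by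
  have hpq := h.pq
  have hpr := h.pr
  have hqr := h.qr
  have hpA := h.pA
  have hqA := h.qA
  have hrA := h.rA
  have hap : a ≠ p := fun e => hpA (e ▸ ha)
  have haq : a ≠ q := fun e => hqA (e ▸ ha)
  have har : a ≠ r := fun e => hrA (e ▸ ha)
  have haA : a ∉ Aᶜ := by simpa using ha
  have hsymm : ∀ x y, addTriangleStar w A a p q r lp lq lr dp dq dr x y =
      addTriangleStar w A a p q r lp lq lr dp dq dr y x := by
    intro x y
    unfold addTriangleStar
    rw [hw.symm, parallelEdges_symm q r, parallelEdges_symm p r, parallelEdges_symm p q,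
      parallelEdges_symm a p, parallelEdges_symm a q, parallelEdges_symm a r]
    simp only [or_comm]
  have hdel : ∀ x ∉ A, ∀ Z : Finset V, Z ⊆ Aᶜ →
      ∑ y ∈ insert a Z, (if x ∈ A ∨ y ∈ A then 0 else w x y) = ∑ y ∈ Z, w x y := by
    intro x hx Z hZ
    rw [sum_insert fun haZ => haA (hZ haZ)]
    simp only [ha, or_true, if_true, zero_add]
    exact sum_congr rfl fun y hy => by simp [hx, mem_compl.1 (hZ hy)]
  refine ⟨hsymm, ?_, ?_, ?_⟩
  · intro x
    simp only [addTriangleStar, hw.loopless, parallelEdges]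
    by_cases h0 : x = a
    · subst h0; simp [hap, haq, har]
    by_cases h1 : x = p
    · subst h1; simp [hpq, hpr, h0]
    by_cases h2 : x = q
    · subst h2; simp [h1, hqr, h0]
    simp [h1, h2, h0]
  · intro x hx
    simp only [addTriangleStar, sum_add_distrib, sum_parallelEdges]
    rcases mem_insert.1 hx with rfl | hx
    · have h0 : ∑ y ∈ insert x Aᶜ, (if x ∈ A ∨ y ∈ A then 0 else w x y) = 0 :=
        sum_eq_zero fun y _ => by simp [ha]
      rw [h0]
      simp [*]
    have h0 : x ≠ a := fun e => haA (e ▸ hx)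
    have h5 := hw.regular x (mem_univ x)
    rw [← sum_add_sum_compl A] at h5
    rw [hdel x (mem_compl.1 hx) _ subset_rfl]
    by_cases h1 : x = p
    · subst h1; simp [*]; omega
    by_cases h2 : x = q
    · subst h2; simp [*, hpq.symm]; omega
    by_cases h3 : x = r
    · subst h3; simp [*, hpr.symm, hqr.symm]; omega
    rw [h.sum_row_eq_zero hw.symm (mem_compl.1 hx) h1 h2 h3] at h5
    simp [h0, h1, h2, h3]
    omega
  · refine conn_of_compl hsymm (P := fun Y => a ∉ Y) (fun Y _ => ?_) fun Y hYS haY hY _ => ?_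
    · by_cases h : a ∈ Y <;> simp [h]
    · have hYA : Y ⊆ Aᶜ := fun y hy => (mem_insert.1 (hYS hy)).resolve_left fun h => haY (h ▸ hy)
      have hne : Y ≠ univ := fun h => haY (h ▸ mem_univ a)
      have h5 := hw.conn Y (subset_univ _) hY hne
      have hlp := hlp Y hYA
      have hlq := hlq Y hYA
      have hlr := hlr Y hYA
      rw [← compl_eq_univ_sdiff] at h5
      rw [h.cut_eq hw.symm hYA, ← hp, ← hq, ← hr] at h5 hlp hlq hlr
      have h0 : edgesBetween (fun x y => if x ∈ A ∨ y ∈ A then 0 else w x y) Y (insert a Aᶜ \ Y) =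
          edgesBetween w Y (Aᶜ \ Y) := by
        rw [insert_sdiff_of_notMem _ haY]
        exact sum_congr rfl fun x hx => hdel x (mem_compl.1 (hYA hx)) _ sdiff_subset
      unfold addTriangleStar
      simp only [edgesBetween_add, edgesBetween_parallelEdges, h0]
      clear hp hq hr h0 hsymm hdel
      by_cases h1 : p ∈ Y <;> by_cases h2 : q ∈ Y <;> by_cases h3 : r ∈ Y <;>
        simp_all [mem_sdiff, mem_compl] <;> omega

end IsThreeCut

end ThreeCut

/-! ### Gluing along a three-vertex-cut -/

section Gluing

/-- If every label `z` is carried by at most as many `j` (via `P`) as `i` (via `Q`), then the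
labelled `j` can be matched with equally labelled `i` by a permutation. -/
theorem exists_perm_of_card_label_le {ι T : Type*} [Fintype ι] [DecidableEq ι]
    {P Q : ι → T → Prop} [∀ z, DecidablePred (P · z)] [∀ z, DecidablePred (Q · z)]
    (hP : ∀ j z z', P j z → P j z' → z = z') (hQ : ∀ i z z', Q i z → Q i z' → z = z')
    (hcard : ∀ z, #{j | P j z} ≤ #{i | Q i z}) :
    ∃ π : Equiv.Perm ι, ∀ j z, P j z → Q (π j) z := by
  classical
  have h1 : ∀ z, ∃ φ : ι → ι, (∀ j, P j z → Q (φ j) z) ∧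
      ∀ j j', P j z → P j' z → φ j = φ j' → j = j' := by
    intro z
    obtain ⟨e⟩ : Nonempty ({j // P j z} ↪ {i // Q i z}) :=
      Function.Embedding.nonempty_of_card_le (by
        rw [Fintype.card_subtype, Fintype.card_subtype]; exact hcard z)
    refine ⟨fun j => if h : P j z then e ⟨j, h⟩ else j, fun j hj => ?_, fun j j' hj hj' h => ?_⟩
    · simp only [hj, dif_pos]
      exact (e ⟨j, hj⟩).2
    · simp only [hj, hj', dif_pos] at h
      exact congrArg Subtype.val (e.injective (Subtype.ext h))
  choose φ hφ hφi using h1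
  let f : ι → ι := fun j => if h : ∃ z, P j z then φ h.choose j else j
  have hf : ∀ j z, P j z → f j = φ z j := by
    intro j z hj
    have h : ∃ z, P j z := ⟨z, hj⟩
    simp only [f, h, dif_pos]
    rw [hP j _ _ h.choose_spec hj]
  obtain ⟨g, hg⟩ := exists_equiv_extend_of_card_eq (t := univ) card_univ.symm
    (s := univ.filter fun j => ∃ z, P j z) (f := f) (subset_univ _) (by
      intro j hj j' hj' h
      obtain ⟨z, hz⟩ : ∃ z, P j z := by simpa using hj
      obtain ⟨z', hz'⟩ : ∃ z, P j' z := by simpa using hj'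
      rw [hf j z hz, hf j' z' hz'] at h
      obtain rfl : z = z' := hQ _ _ _ (hφ z j hz) (h ▸ hφ z' j' hz')
      exact hφi z j j' hz hz' h)
  refine ⟨g.trans (Equiv.subtypeUnivEquiv mem_univ), fun j z hj => ?_⟩
  have := hg j (by simpa using ⟨z, hj⟩)
  simp only [Equiv.trans_apply, Equiv.subtypeUnivEquiv_apply, this, hf j z hj]
  exact hφ z j hj

variable {V : Type*}

namespace IsThreeCut

variable {w : V → V → ℕ} {A B : Finset V} {p q r : V}

/-- Every separating vertex can be given the role of the first one. -/
theorem exists_of_notMem (h : IsThreeCut w A B p q r) {z : V} (hA : z ∉ A) (hB : z ∉ B) :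
    ∃ q' r', IsThreeCut w A B z q' r' := by
  rcases h.cover z hA hB with rfl | rfl | rfl
  · exact ⟨_, _, h⟩
  · exact ⟨_, _, h.swap_left⟩
  · exact ⟨_, _, h.swap_right.swap_left⟩

theorem forall_iff (h : IsThreeCut w A B p q r) {P : V → Prop} :
    (∀ x, x ∉ A → x ∉ B → x ≠ p → P x) ↔ P q ∧ P r := by
  refine ⟨fun hP => ⟨hP q h.qA h.qB h.pq.symm, hP r h.rA h.rB h.pr.symm⟩, fun hP x hA hB hx => ?_⟩
  rcases h.cover x hA hB with rfl | rfl | rfl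
  exacts [absurd rfl hx, hP.1, hP.2]

variable [DecidableEq V]

/-- In a matching of `G[A ∪ {p, q, r}]` the vertex `p` is the only separating vertex matched into
`A` if and only if `q` and `r` are matched to each other. -/
theorem matched_left_iff (h : IsThreeCut w A B p q r) {f : V → V} (hf : ∀ x ∉ B, f x ∉ B)
    (hf2 : ∀ x ∉ B, f (f x) = x) (hf0 : ∀ x ∉ B, f x ≠ x) :
    (f p ∈ A ∧ f q ∉ A ∧ f r ∉ A) ↔ f q = r := by
  have hcov : ∀ x ∉ B, f x ∉ A → f x = p ∨ f x = q ∨ f x = r := fun x hx hA =>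
    h.cover _ hA (hf x hx)
  have := hf2 p h.pB
  have := hf2 q h.qB
  have := hf2 r h.rB
  have := hf0 p h.pB
  have := hf0 q h.qB
  have := hf0 r h.rB
  have hp := hcov p h.pB
  have hq := hcov q h.qB
  have hr := hcov r h.rB
  have := h.pA
  have := h.qA
  have := h.rA
  have := h.pq
  have := h.pr
  have := h.qr
  constructor
  · rintro ⟨h1, h2, h3⟩
    rcases hq h2 with h4 | h4 | h4 <;> simp_all
  · intro h4
    have h5 : f r = q := by rw [← h4]; assumption
    refine ⟨?_, by simp_all, by simp_all⟩
    by_contra h6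
    rcases hp h6 with h7 | h7 | h7 <;> simp_all

/-- In a matching of the graph on `B ∪ {a, p, q, r}`, in which `a` is matched to `p`, the vertices
`q` and `r` are either both matched into `B` or matched to each other. -/
theorem matched_right_iff (h : IsThreeCut w A B p q r) {a : V} (ha : a ∈ A) {g : V → V}
    (hg : ∀ x, x ∉ A ∨ x = a → g x ∉ A ∨ g x = a) (hg2 : ∀ x, x ∉ A ∨ x = a → g (g x) = x)
    (hg0 : ∀ x, x ∉ A ∨ x = a → g x ≠ x) (hgB : g a ∉ B) :
    g p = a ↔ (g p = a ∧ g q ∈ B ∧ g r ∈ B) ∨ g q = r := by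
  have := hg2 p (.inl h.pA)
  have := hg2 q (.inl h.qA)
  have := hg2 r (.inl h.rA)
  have := hg2 a (.inr rfl)
  have := hg0 p (.inl h.pA)
  have := hg0 q (.inl h.qA)
  have := hg0 r (.inl h.rA)
  have hga := hg0 a (.inr rfl)
  have hap : a ≠ p := fun e => h.pA (e ▸ ha)
  have haq : a ≠ q := fun e => h.qA (e ▸ ha)
  have har : a ≠ r := fun e => h.rA (e ▸ ha)
  have := h.pq
  have := h.pr
  have := h.qr
  have hcov : ∀ x, x ∉ A → g x ∈ B ∨ g x = a ∨ g x = p ∨ g x = q ∨ g x = r := by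
    intro x hx
    rcases hg x (.inl hx) with h1 | h1
    · by_cases h2 : g x ∈ B
      · exact .inl h2
      · exact .inr (.inr (h.cover _ h1 h2))
    · exact .inr (.inl h1)
  constructor
  · intro h1
    have h2 : g a = p := by rw [← h1]; assumption
    by_cases h3 : g q = r
    · exact .inr h3
    · refine .inl ⟨h1, ?_, ?_⟩
      · rcases hcov q h.qA with h4 | h4 | h4 | h4 | h4
        · exact h4
        all_goals exfalso; simp_all
      · rcases hcov r h.rA with h4 | h4 | h4 | h4 | h4
        · exact h4
        all_goals exfalso; simp_all
  · rintro (h1 | h1)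
    · exact h1.1
    · have h5 : g r = q := by rw [← h1]; assumption
      have hA : g a ∉ A := (hg a (.inr rfl)).resolve_right hga
      rcases h.cover _ hA hgB with h2 | h2 | h2
      · rw [← h2]; assumption
      all_goals exfalso; simp_all

variable [Fintype V]

/-- Decompositions `f` of `G[A ∪ X]` plus edges, and `g` of the graph on `B ∪ X ∪ {a}`, glue to a
decomposition of `G`. In each `g j` the vertex `a` is matched to some `z ∈ X`; if the other two
vertices of `X` are matched into `B`, then `g j` has to be combined with an `f i` in which these two
are matched to each other. The last hypothesis says that there are enough such `i`. Any bijection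
with this property will do: the multiplicities between vertices of `X` come out right because `w`
is regular. -/
theorem isMatchingSum_of_sides (h : IsThreeCut w A B p q r) (hw : IsFiveConnected w univ) {a : V}
    (ha : a ∈ A) {w₁ w₂ : V → V → ℕ} (hm₁ : IsMatchingSum (Fin 5) w₁ Bᶜ)
    (hm₂ : IsMatchingSum (Fin 5) w₂ (insert a Aᶜ)) (h₁ : ∀ x ∈ A, ∀ y ∉ B, w₁ x y = w x y)
    (h₁0 : ∀ x, w₁ x x = 0) (h₂ : ∀ x ∈ B, ∀ y ∉ A, w₂ x y = w x y) (h₂0 : ∀ x, w₂ x x = 0)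
    (h₂a : ∀ x ∈ B, w₂ a x = 0)
    (hN : ∀ p q r, IsThreeCut w A B p q r → w₂ p a ≤ w₁ q r + w₂ q r) :
    IsMatchingSum (Fin 5) w univ := by
  obtain ⟨f, hf, hfc⟩ := hm₁
  obtain ⟨g, hg, hgc⟩ := hm₂
  have ne_of_count : ∀ (F : Fin 5 → V → V) (x y : V), #{i | F i x = y} = 0 → ∀ i, F i x ≠ y :=
    fun F x y h0 i => filter_eq_empty_iff.1 (card_eq_zero.1 h0) (mem_univ i)
  simp only [mem_compl] at hf hfc
  simp only [mem_insert, mem_compl] at hg hgc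
  have hBA : ∀ x ∈ B, x ∉ A := fun x hx hx' => disjoint_left.1 h.disj hx' hx
  have hf1 : ∀ i, ∀ x ∉ B, f i x ∉ B := fun i x hx => (hf i x hx).1
  have hf2 : ∀ i, ∀ x ∉ B, f i (f i x) = x := fun i x hx => (hf i x hx).2
  have hf0 : ∀ i, ∀ x ∉ B, f i x ≠ x := fun i x hx =>
    ne_of_count f x x (by rw [hfc x hx x hx, h₁0]) i
  have hg1 : ∀ j, ∀ x, x ∉ A ∨ x = a → g j x ∉ A ∨ g j x = a := fun j x hx =>
    ((hg j x hx.symm).1).symm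
  have hg2 : ∀ j, ∀ x, x ∉ A ∨ x = a → g j (g j x) = x := fun j x hx => (hg j x hx.symm).2
  have hg0 : ∀ j, ∀ x, x ∉ A ∨ x = a → g j x ≠ x := fun j x hx =>
    ne_of_count g x x (by rw [hgc x hx.symm x hx.symm, h₂0]) j
  have hga : ∀ j, g j a ∉ B := fun j hj =>
    ne_of_count g a (g j a) (by rw [hgc a (.inl rfl) _ (.inr (hBA _ hj)), h₂a _ hj]) j rfl
  have hgaA : ∀ j, g j a ∉ A := fun j => (hg1 j a (.inr rfl)).resolve_right (hg0 j a (.inr rfl))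
  have hgB : ∀ j, ∀ x ∈ B, g j x ∉ A := fun j x hx => (hg1 j x (.inl (hBA x hx))).resolve_right
    fun e => hga j (by rw [← e, hg2 j x (.inl (hBA x hx))]; exact hx)
  obtain ⟨π, hπ⟩ := exists_perm_of_card_label_le
    (P := fun j z => z ∉ A ∧ z ∉ B ∧ g j z = a ∧ ∀ x, x ∉ A → x ∉ B → x ≠ z → g j x ∈ B)
    (Q := fun i z => z ∉ A ∧ z ∉ B ∧ f i z ∈ A ∧ ∀ x, x ∉ A → x ∉ B → x ≠ z → f i x ∉ A)
    (fun j z z' hz hz' => by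
      rw [← hg2 j z (.inl hz.1), ← hg2 j z' (.inl hz'.1), hz.2.2.1, hz'.2.2.1])
    (fun i z z' hz hz' => by
      by_contra hne
      exact hz.2.2.2 z' hz'.1 hz'.2.1 (Ne.symm hne) hz'.2.2.1)
    (fun z => by
      by_cases hzA : z ∈ A
      · simp [hzA]
      by_cases hzB : z ∈ B
      · simp [hzB]
      obtain ⟨x, y, hz⟩ := h.exists_of_notMem hzA hzB
      simp only [hzA, hzB, not_false_eq_true, true_and, hz.forall_iff]
      have e1 : #{i | f i z ∈ A ∧ f i x ∉ A ∧ f i y ∉ A} = w₁ x y := by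
        rw [← hfc x hz.qB y hz.rB]
        congr 1
        ext i
        simp only [mem_filter, mem_univ, true_and]
        exact hz.matched_left_iff (hf1 i) (hf2 i) (hf0 i)
      have e2 : #{j | g j z = a ∧ g j x ∈ B ∧ g j y ∈ B} + w₂ x y = w₂ z a := by
        rw [← hgc x (.inr hz.qA) y (.inr hz.rA), ← hgc z (.inr hz.pA) a (.inl rfl),
          ← card_union_of_disjoint]
        · congr 1
          ext j
          simp only [mem_filter, mem_univ, true_and, mem_union]
          exact (hz.matched_right_iff ha (hg1 j) (hg2 j) (hg0 j) (hga j)).symm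
        · refine disjoint_left.2 fun j hj hj' => hz.rB ?_
          simp only [mem_filter, mem_univ, true_and] at hj hj'
          exact hj' ▸ hj.2.1
      have := hN z x y hz
      omega)
  -- The two vertices of `X` that `g j` matches into `B` are matched to each other by `f (π j)`.
  have key : ∀ j x, x ∉ A → x ∉ B → g j x ∈ B → f (π j) x ∉ A ∧ g j (f (π j) x) ∈ B := by
    intro j x hxA hxB hx
    obtain ⟨y, z, hz⟩ := h.exists_of_notMem (hgaA j) (hga j)
    have hP : g j (g j a) = a ∧ g j y ∈ B ∧ g j z ∈ B := by
      rcases (hz.matched_right_iff ha (hg1 j) (hg2 j) (hg0 j) (hga j)).1 (hg2 j a (.inr rfl)) with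
        h1 | h1
      · exact h1
      · exfalso
        have h2 : g j z = y := by rw [← h1, hg2 j y (.inl hz.qA)]
        rcases hz.cover x hxA hxB with rfl | rfl | rfl
        · rw [hg2 j a (.inr rfl)] at hx
          exact hBA a hx ha
        · exact hz.rB (h1 ▸ hx)
        · exact hz.qB (h2 ▸ hx)
    obtain ⟨-, -, hQ1, hQ2⟩ := hπ j (g j a) ⟨hgaA j, hga j, hP.1, hz.forall_iff.2 hP.2⟩
    have hxz : x ≠ g j a := by
      rintro rfl
      rw [hP.1] at hx
      exact hBA a hx ha
    have h3 := hQ2 x hxA hxB hxz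
    refine ⟨h3, (hz.forall_iff (P := fun x => g j x ∈ B)).2 hP.2 _ h3 (hf1 _ x hxB) fun e => hxA ?_⟩
    rw [← hf2 (π j) x hxB, e]
    exact hQ1
  -- For each `j` the sets on which the two matchings are used are closed under them, by `key`.
  let F : Fin 5 → V → V := fun j u =>
    if u ∈ A ∨ (u ∉ B ∧ g j u ∉ B) then f (π j) u else g j u
  have hFA : ∀ j, ∀ u ∈ A, F j u = f (π j) u := fun j u hu => if_pos (.inl hu)
  have hFB : ∀ j, ∀ u ∈ B, F j u = g j u := fun j u hu => if_neg (by simp [hu, hBA u hu])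
  have hAB : ∀ x ∈ A, x ∉ B := fun x hx => disjoint_left.1 h.disj hx
  have hF2 : ∀ j u, F j (F j u) = u := by
    intro j u
    by_cases hu : u ∈ A ∨ (u ∉ B ∧ g j u ∉ B)
    · have huB : u ∉ B := hu.elim (hAB u) And.left
      have e : F j u = f (π j) u := if_pos hu
      rw [e]
      by_cases h1 : f (π j) u ∈ A
      · rw [hFA j _ h1, hf2 _ u huB]
      · have h2 : g j (f (π j) u) ∉ B := by
          intro h3
          have h4 := key j _ h1 (hf1 _ u huB) h3
          rw [hf2 _ u huB] at h4
          exact hu.elim h4.1 fun h5 => h5.2 h4.2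
        have e' : F j (f (π j) u) = f (π j) (f (π j) u) := if_pos (.inr ⟨hf1 _ u huB, h2⟩)
        rw [e', hf2 _ u huB]
    · have e : F j u = g j u := if_neg hu
      have huA : u ∉ A := fun h1 => hu (.inl h1)
      have h0 := hg2 j u (.inl huA)
      rw [e]
      by_cases huB : u ∈ B
      · have e' : F j (g j u) = g j (g j u) := if_neg (by simp [hgB j u huB, h0, huB])
        rw [e', h0]
      · rw [hFB j _ (by by_contra h1; exact hu (.inr ⟨huB, h1⟩)), h0]
  have hF0 : ∀ j u, F j u ≠ u := by
    intro j u
    by_cases hu : u ∈ A ∨ (u ∉ B ∧ g j u ∉ B)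
    · have e : F j u = f (π j) u := if_pos hu
      exact e ▸ hf0 _ u (hu.elim (hAB u) And.left)
    · have e : F j u = g j u := if_neg hu
      exact e ▸ hg0 _ u (.inl fun h1 => hu (.inl h1))
  have hsymm : ∀ u v, #{j | F j u = v} = #{j | F j v = u} := by
    intro u v
    congr 1
    ext j
    simp only [mem_filter, mem_univ, true_and]
    constructor <;> rintro rfl <;> exact hF2 j _
  have hcA : ∀ u ∈ A, ∀ v, #{j | F j u = v} = w u v := by
    intro u hu v
    simp only [hFA _ u hu]
    by_cases hv : v ∈ B
    · have : ∀ j, f (π j) u ≠ v := fun j e => hf1 _ u (hAB u hu) (e ▸ hv)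
      simp [this, h.noEdge u hu v hv]
    · rw [← h₁ u hu v hv, ← hfc u (hAB u hu) v hv]
      exact card_bij (fun j _ => π j) (by simp) (by simp) fun i hi => ⟨π.symm i, by simpa using hi⟩
  have hcB : ∀ u ∈ B, ∀ v, #{j | F j u = v} = w u v := by
    intro u hu v
    simp only [hFB _ u hu]
    by_cases hv : v ∈ A
    · have : ∀ j, g j u ≠ v := fun j e => hgB j u hu (e ▸ hv)
      simp [this, hw.symm u v, h.noEdge v hv u hu]
    · rw [← h₂ u hu v hv, ← hgc u (.inr (hBA u hu)) v (.inr hv)]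
  -- Inside `X` the three unknown multiplicities are determined by the three degree equations.
  have hrow : ∀ p q r, IsThreeCut w A B p q r →
      #{j | F j p = q} + #{j | F j p = r} = w p q + w p r := by
    intro p q r h
    have h5 : ∑ v, #{j | F j p = v} = 5 := by
      rw [← card_eq_sum_card_fiberwise (fun _ _ => mem_univ _)]
      simp
    have h8 : ∑ v ∈ A, w p v + ∑ v ∈ B, w p v + w p p + w p q + w p r = 5 := by
      rw [← h.sum_univ (fun v => w p v)]
      exact hw.regular p (mem_univ p)
    have hA : ∑ v ∈ A, #{j | F j p = v} = ∑ v ∈ A, w p v :=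
      sum_congr rfl fun v hv => (hsymm p v).trans ((hcA v hv p).trans (hw.symm v p))
    have hB : ∑ v ∈ B, #{j | F j p = v} = ∑ v ∈ B, w p v :=
      sum_congr rfl fun v hv => (hsymm p v).trans ((hcB v hv p).trans (hw.symm v p))
    rw [h.sum_univ, hA, hB] at h5
    have h6 : #{j | F j p = p} = 0 := by simp [hF0]
    have h7 := hw.loopless p
    omega
  have hpair : ∀ p q r, IsThreeCut w A B p q r → #{j | F j p = q} = w p q := by
    intro p q r h
    have h1 := hrow p q r h
    have h2 := hrow q p r h.swap_left
    have h3 := hrow r p q h.swap_right.swap_left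
    have := hsymm p q
    have := hsymm p r
    have := hsymm q r
    have := hw.symm p q
    have := hw.symm p r
    have := hw.symm q r
    omega
  refine ⟨F, fun j u _ => ⟨mem_univ _, hF2 j u⟩, fun u _ v _ => ?_⟩
  by_cases huA : u ∈ A
  · exact hcA u huA v
  by_cases huB : u ∈ B
  · exact hcB u huB v
  by_cases hvA : v ∈ A
  · rw [hsymm, hcA v hvA, hw.symm]
  by_cases hvB : v ∈ B
  · rw [hsymm, hcB v hvB, hw.symm]
  obtain ⟨x, y, hu⟩ := h.exists_of_notMem huA huB
  rcases hu.cover v hvA hvB with rfl | rfl | rfl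
  · simp [hF0, hw.loopless]
  · exact hpair _ _ _ hu
  · exact hpair _ _ _ hu.swap_right

end IsThreeCut

end Gluing

/-! ### Three-vertex-cuts in a minimal counterexample -/

section Reduction

variable {V : Type*} [DecidableEq V] [Fintype V] {w : V → V → ℕ} {A B : Finset V} {p q r : V}

namespace IsThreeCut

/-- The triangle inequality for the numbers of edges from the separating vertices to `B`. -/
theorem sum_row_le_add (h : IsThreeCut w A B p q r) (hw : IsFiveConnected w univ) :
    ∑ y ∈ B, w p y ≤ ∑ y ∈ B, w q y + ∑ y ∈ B, w r y := by
  have hne : insert p B ≠ univ := fun e => by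
    have := e ▸ mem_univ q
    simp [h.pq.symm, h.qB] at this
  have h5 := hw.conn (insert p B) (subset_univ _) (insert_nonempty _ _) hne
  have hc : univ \ insert p B = insert q (insert r A) := by
    ext x
    have h1 := h.cover x
    have h2 : x ∈ A → x ∉ B := fun h' => disjoint_left.1 h.disj h'
    have := h.pA
    have := h.qB
    have := h.rB
    have := h.pq
    have := h.pr
    simp only [mem_sdiff, mem_univ, mem_insert, true_and]
    constructor
    · tauto
    · rintro (rfl | rfl | h3)
      · exact not_or.2 ⟨Ne.symm ‹_›, ‹_›⟩
      · exact not_or.2 ⟨Ne.symm ‹_›, ‹_›⟩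
      · exact not_or.2 ⟨by rintro rfl; contradiction, h2 h3⟩
  have hrow : ∀ x, ∑ y ∈ insert q (insert r A), w x y = w q x + w r x + ∑ y ∈ A, w x y := by
    intro x
    rw [sum_insert (by simp [h.qr, h.qA]), sum_insert h.rA, hw.symm x q, hw.symm x r]
    ring
  have h0 : ∑ x ∈ B, ∑ y ∈ A, w x y = 0 :=
    sum_eq_zero fun x hx => sum_eq_zero fun y hy => by rw [hw.symm, h.noEdge y hy x hx]
  rw [hc, edgesBetween, sum_insert h.pB] at h5
  simp only [hrow, sum_add_distrib, h0] at h5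
  have := h.sum_row hw
  have := hw.symm p q
  have := hw.symm p r
  omega

/-- Two sets that separate different pairs of separating vertices from `A` uncross: if both have
cuts of size at most six, then submodularity forces the cuts of their intersection and their union
to have sizes five and seven. Hence the intersection is a single vertex, and the union is everything
outside `A`. -/
theorem uncross (h : IsThreeCut w A B p q r) (hw : IsMinimalCounterexample w) (hA : 3 ≤ #A)
    (hcut : 7 ≤ edgesBetween w A Aᶜ) {Y Z : Finset V} (hY : Y ⊆ Aᶜ) (hZ : Z ⊆ Aᶜ) (hpY : p ∈ Y)
    (hqY : q ∉ Y) (hrY : r ∈ Y) (hpZ : p ∈ Z) (hqZ : q ∈ Z) (hYc : edgesBetween w Y Yᶜ ≤ 6)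
    (hZc : edgesBetween w Z Zᶜ ≤ 6) :
    edgesBetween w A Aᶜ = 7 ∧ ∀ b ∈ B, (b ∈ Y ∨ b ∈ Z) ∧ (b ∉ Y ∨ b ∉ Z) := by
  have hw5 := hw.fiveConnected
  have hsub := edgesBetween_submodular w Y Z
  have hpI : p ∈ Y ∩ Z := mem_inter.2 ⟨hpY, hpZ⟩
  have hI := hw5.conn (Y ∩ Z) (subset_univ _) ⟨p, hpI⟩ fun e =>
    hqY (mem_inter.1 (e ▸ mem_univ q)).1
  rw [← compl_eq_univ_sdiff] at hI
  have hWA : Y ∪ Z ⊆ Aᶜ := union_subset hY hZ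
  have hU : edgesBetween w (Y ∪ Z) (Y ∪ Z)ᶜ =
      edgesBetween w (Y ∪ Z) (Aᶜ \ (Y ∪ Z)) + edgesBetween w A Aᶜ := by
    rw [h.cut_eq hw5.symm hWA, h.cut_left hw5.symm]
    simp [hpY, hqZ, hrY]
  have hB : Aᶜ \ (Y ∪ Z) = ∅ := by
    by_contra hne
    have hne := nonempty_iff_ne_empty.2 hne
    have h5 := hw5.conn _ (subset_univ _) hne fun e => by
      have := e ▸ mem_univ p
      simp [hpY] at this
    have hc : univ \ (Aᶜ \ (Y ∪ Z)) = (Y ∪ Z) ∪ A := by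
      ext x
      have := @hWA x
      simp only [mem_sdiff, mem_univ, true_and, mem_union, mem_compl] at *
      tauto
    have h0 : edgesBetween w (Aᶜ \ (Y ∪ Z)) A = 0 := by
      refine edgesBetween_eq_zero fun x hx y hy => ?_
      simp only [mem_sdiff, mem_compl, mem_union, not_or] at hx
      have hxB : x ∈ B := by
        by_contra hxB
        rcases h.cover x hx.1 hxB with rfl | rfl | rfl
        exacts [hx.2.1 hpY, hx.2.2 hqZ, hx.2.1 hrY]
      rw [hw5.symm, h.noEdge y hy x hxB]
    rw [hc, edgesBetween_union_right (disjoint_left.2 fun x hx hx' => mem_compl.1 (hWA hx) hx'),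
      h0, edgesBetween_comm hw5.symm] at h5
    omega
  have hcard : #(Y ∩ Z) = 1 := by
    refine (hw.card_eq_one_of_cut_eq_five (by omega)).resolve_right fun h1 => ?_
    have h2 : A ⊆ (Y ∩ Z)ᶜ := fun x hx => mem_compl.2 fun hx' =>
      mem_compl.1 (hY (mem_inter.1 hx').1) hx
    have := card_le_card h2
    omega
  refine ⟨by omega, fun b hb => ⟨?_, ?_⟩⟩
  · by_contra hn
    refine notMem_empty b (hB ▸ ?_)
    simp only [mem_sdiff, mem_compl, mem_union]
    exact ⟨fun hbA => disjoint_left.1 h.disj hbA hb, hn⟩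
  · by_contra! hn
    refine h.pB ?_
    rwa [card_le_one.1 hcard.le p hpI b (mem_inter.2 hn)]

/-- Some cut of size at most six separates `q` and `r` from `p` and `A`, so that lifting edges
from `A` to `q` and `r` produces a cut with fewer than five edges. -/
def HasSmallCut (w : V → V → ℕ) (A : Finset V) (p q r : V) : Prop :=
  ∃ Y ⊆ Aᶜ, p ∉ Y ∧ q ∈ Y ∧ r ∈ Y ∧ edgesBetween w Y Yᶜ ≤ 6

/-- If `A` has more than seven outgoing edges, then at most one pair of separating vertices is bad
for lifting. -/
theorem not_hasSmallCut_and (h : IsThreeCut w A B p q r) (hw : IsMinimalCounterexample w)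
    (hA : 3 ≤ #A) (hcut : 7 < edgesBetween w A Aᶜ) (h1 : HasSmallCut w A p q r) :
    ¬ HasSmallCut w A q p r := by
  rintro ⟨Z, hZA, hqZ, hpZ, hrZ, hZ⟩
  obtain ⟨Y, hYA, hpY, hqY, hrY, hY⟩ := h1
  have := (h.swap_right.swap_left.uncross hw hA hcut.le hYA hZA hrY hpY hqY hrZ hpZ hY hZ).1
  omega

/-- Any two of the three small cuts would split `B` into complementary parts, which is impossible
for three sets. -/
theorem not_hasSmallCut_all (h : IsThreeCut w A B p q r) (hw : IsMinimalCounterexample w)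
    (hA : 3 ≤ #A) (hB : B.Nonempty) (hcut : 7 ≤ edgesBetween w A Aᶜ)
    (h1 : HasSmallCut w A p q r) (h2 : HasSmallCut w A q p r) : ¬ HasSmallCut w A r p q := by
  rintro ⟨W, hWA, hrW, hpW, hqW, hW⟩
  obtain ⟨Z, hZA, hqZ, hpZ, hrZ, hZ⟩ := h2
  obtain ⟨Y, hYA, hpY, hqY, hrY, hY⟩ := h1
  obtain ⟨b, hb⟩ := hB
  have h1 := (h.swap_right.swap_left.uncross hw hA hcut hYA hZA hrY hpY hqY hrZ hpZ hY hZ).2 b hb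
  have h2 := (h.swap_left.uncross hw hA hcut hYA hWA hqY hpY hrY hqW hpW hY hW).2 b hb
  have h3 := (h.uncross hw hA hcut hZA hWA hpZ hqZ hrZ hpW hqW hZ hW).2 b hb
  tauto

theorem le_cut_of_not_hasSmallCut (hw : IsFiveConnected w univ) {l : ℕ} (hl : l ≤ 1)
    (hn : l = 1 → ¬ HasSmallCut w A p q r) :
    ∀ Y ⊆ Aᶜ, p ∉ Y → q ∈ Y → r ∈ Y → 5 + 2 * l ≤ edgesBetween w Y Yᶜ := by
  intro Y hY h1 h2 h3
  by_contra hlt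
  have := hw.conn Y (subset_univ _) ⟨q, h2⟩ fun e => h1 (e ▸ mem_univ p)
  rw [← compl_eq_univ_sdiff] at this
  exact hn (by omega) ⟨Y, hY, h1, h2, h3, by omega⟩

/-- If `A` has `5 + 2 * L` outgoing edges, then `L` pairs of them can be lifted, each at a different
pair of separating vertices, without destroying `5`-edge-connectivity. -/
theorem exists_lifting (h : IsThreeCut w A B p q r) (hw : IsMinimalCounterexample w) (hA : 3 ≤ #A)
    (hB : B.Nonempty) {L : ℕ} (hcut : edgesBetween w A Aᶜ = 5 + 2 * L) (hL1 : 1 ≤ L)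
    (hL2 : L ≤ 2) :
    ∃ lp lq lr : ℕ, lp + lq + lr = L ∧
      (∀ Y ⊆ Aᶜ, p ∉ Y → q ∈ Y → r ∈ Y → 5 + 2 * lp ≤ edgesBetween w Y Yᶜ) ∧
      (∀ Y ⊆ Aᶜ, q ∉ Y → p ∈ Y → r ∈ Y → 5 + 2 * lq ≤ edgesBetween w Y Yᶜ) ∧
      (∀ Y ⊆ Aᶜ, r ∉ Y → p ∈ Y → q ∈ Y → 5 + 2 * lr ≤ edgesBetween w Y Yᶜ) := by
  suffices H : ∃ lp lq lr : ℕ, lp + lq + lr = L ∧ (lp ≤ 1 ∧ lq ≤ 1 ∧ lr ≤ 1) ∧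
      (lp = 1 → ¬ HasSmallCut w A p q r) ∧ (lq = 1 → ¬ HasSmallCut w A q p r) ∧
      (lr = 1 → ¬ HasSmallCut w A r p q) by
    obtain ⟨lp, lq, lr, hl, ⟨hp1, hq1, hr1⟩, hp, hq, hr⟩ := H
    exact ⟨lp, lq, lr, hl, le_cut_of_not_hasSmallCut hw.fiveConnected hp1 hp,
      le_cut_of_not_hasSmallCut hw.fiveConnected hq1 hq,
      le_cut_of_not_hasSmallCut hw.fiveConnected hr1 hr⟩
  obtain rfl | rfl : L = 1 ∨ L = 2 := by omega
  · have hall := h.not_hasSmallCut_all hw hA hB (by omega)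
    by_cases hp : HasSmallCut w A p q r
    · by_cases hq : HasSmallCut w A q p r
      · exact ⟨0, 0, 1, by simp [hall hp hq]⟩
      · exact ⟨0, 1, 0, by simp [hq]⟩
    · exact ⟨1, 0, 0, by simp [hp]⟩
  · have hcomm : ∀ x y z, HasSmallCut w A x y z → HasSmallCut w A x z y :=
      fun x y z ⟨Y, h1, h2, h3, h4, h5⟩ => ⟨Y, h1, h2, h4, h3, h5⟩
    have hpq := h.not_hasSmallCut_and hw hA (by omega)
    have hpr := h.swap_right.not_hasSmallCut_and hw hA (by omega)
    have hqr := h.swap_left.swap_right.not_hasSmallCut_and hw hA (by omega)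
    by_cases hp : HasSmallCut w A p q r
    · exact ⟨0, 1, 1, by simp [hpq hp, hpr (hcomm _ _ _ hp)]⟩
    · by_cases hq : HasSmallCut w A q p r
      · exact ⟨1, 0, 1, by simp [hp, mt (hcomm _ _ _) (hqr (hcomm _ _ _ hq))]⟩
      · exact ⟨1, 1, 0, by simp [hp, hq]⟩

end IsThreeCut

/-- In a minimal counterexample no three vertices separate an odd set with more than one vertex
from a non-empty set. -/
theorem IsMinimalCounterexample.card_eq_one_of_isThreeCut (hw : IsMinimalCounterexample w)
    (h : IsThreeCut w A B p q r) (hodd : Odd #A) (hB : B.Nonempty) : #A = 1 := by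
  by_contra hA1
  have hw5 := hw.fiveConnected
  have hA : 3 ≤ #A := by
    obtain ⟨k, hk⟩ := hodd
    omega
  obtain ⟨a, ha⟩ : A.Nonempty := card_pos.1 (by omega)
  have h' := h.swap_sides hw5.symm
  have hcardV : #(univ : Finset V) = #A + #B + 3 := by
    have := h.sum_univ (fun _ => 1)
    simpa using this
  have hevenB : Even #B := by
    have h1 := hw5.even_card
    rw [hcardV] at h1
    grind
  -- The numbers of edges leaving `A` and `B`.
  have hcA := h.cut_left hw5.symm
  have hcB := h'.cut_left hw5.symm
  have hparA := hw5.even_card_add (subset_univ A)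
  have hparB := hw5.even_card_add (subset_univ B)
  have hA5 := hw5.conn A (subset_univ _) ⟨a, ha⟩ fun e => h.pA (e ▸ mem_univ p)
  have hB5 := hw5.conn B (subset_univ _) hB fun e => h.pB (e ▸ mem_univ p)
  rw [← compl_eq_univ_sdiff] at hparA hparB hA5 hB5
  have hA7 : edgesBetween w A Aᶜ ≠ 5 := by
    intro h5
    refine (hw.card_eq_one_of_cut_eq_five h5).elim hA1 fun h1 => h.pq ?_
    exact card_le_one.1 h1.le p (mem_compl.2 h.pA) q (mem_compl.2 h.qA)
  have hrp := h.sum_row hw5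
  have hrq := h.swap_left.sum_row hw5
  have hrr := h.swap_right.swap_left.sum_row hw5
  rw [hw5.symm q p] at hrq
  rw [hw5.symm r p, hw5.symm r q] at hrr
  have htp := h.sum_row_le_add hw5
  have htq := h.swap_left.sum_row_le_add hw5
  have htr := h.swap_right.swap_left.sum_row_le_add hw5
  obtain ⟨L, hL⟩ : ∃ L, edgesBetween w A Aᶜ = 5 + 2 * L := by
    obtain ⟨k, hk⟩ := hodd
    obtain ⟨m, hm⟩ := hparA
    exact ⟨m - k - 3, by omega⟩
  obtain ⟨s, hs⟩ : ∃ s, edgesBetween w B Bᶜ = 2 * s := by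
    obtain ⟨k, hk⟩ := hevenB
    obtain ⟨m, hm⟩ := hparB
    exact ⟨m - k, by omega⟩
  obtain ⟨lp, lq, lr, hl, hlp, hlq, hlr⟩ := h.exists_lifting hw hA hB hL (by omega) (by omega)
  -- The degrees force `np` to be half of `|∂(B)|` minus the number of edges from `p` to `B`.
  obtain ⟨np, nq, nr, hnp, hnq, hnr⟩ : ∃ np nq nr : ℕ, nq + nr = ∑ y ∈ B, w p y ∧
      np + nr = ∑ y ∈ B, w q y ∧ np + nq = ∑ y ∈ B, w r y := by
    refine ⟨s - ∑ y ∈ B, w p y, s - ∑ y ∈ B, w q y, s - ∑ y ∈ B, w r y, ?_, ?_, ?_⟩ <;> omega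
  have hG₁ := h.isFiveConnected_addTriangle hw5 hnp hnq hnr
  -- `a` keeps the edges to `p` that are not lifted; by the degrees their number is
  -- `np + lp + w q r`.
  have hG₂ := h.isFiveConnected_addTriangleStar hw5 ha (lp := lp) (lq := lq) (lr := lr)
    (dp := np + lp + w q r) (dq := nq + lq + w p r) (dr := nr + lr + w p q)
    (by omega) (by omega) (by omega) (by omega) hlp
    (fun Y hY h1 h2 h3 => hlq Y hY h2 h1 h3) (fun Y hY h1 h2 h3 => hlr Y hY h3 h1 h2)
  have hm₁ := hw.minimal _ _ hG₁ (by
    have := card_add_card_compl B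
    have := hB.card_pos
    omega)
  have hm₂ := hw.minimal _ _ hG₂ (by
    have := card_add_card_compl A
    rw [card_insert_of_notMem (by simpa using ha)]
    omega)
  have hpq := h.pq
  have hpr := h.pr
  have hqr := h.qr
  have hap : a ≠ p := fun e => h.pA (e ▸ ha)
  have haq : a ≠ q := fun e => h.qA (e ▸ ha)
  have har : a ≠ r := fun e => h.rA (e ▸ ha)
  refine hw.not_isMatchingSum (h.isMatchingSum_of_sides hw5 ha hm₁ hm₂ ?_ hG₁.loopless ?_
    hG₂.loopless ?_ ?_)
  · intro x hx y _
    have h1 : x ≠ p := fun e => h.pA (e ▸ hx)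
    have h2 : x ≠ q := fun e => h.qA (e ▸ hx)
    have h3 : x ≠ r := fun e => h.rA (e ▸ hx)
    simp [IsThreeCut.addTriangle, parallelEdges, h1, h2, h3]
  · intro x hx y hy
    have hxA : x ∉ A := fun hxA => disjoint_left.1 h.disj hxA hx
    have h0 : x ≠ a := fun e => hxA (e ▸ ha)
    have h1 : x ≠ p := fun e => h.pB (e ▸ hx)
    have h2 : x ≠ q := fun e => h.qB (e ▸ hx)
    have h3 : x ≠ r := fun e => h.rB (e ▸ hx)
    simp [IsThreeCut.addTriangleStar, parallelEdges, h0, h1, h2, h3, hxA, hy]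
  · intro x hx
    have h1 : x ≠ p := fun e => h.pB (e ▸ hx)
    have h2 : x ≠ q := fun e => h.qB (e ▸ hx)
    have h3 : x ≠ r := fun e => h.rB (e ▸ hx)
    simp [IsThreeCut.addTriangleStar, parallelEdges, h1, h2, h3, ha, hap, haq, har]
  · have hs₁ := hG₁.symm
    have hs₂ := hG₂.symm
    set w₁ := IsThreeCut.addTriangle w p q r np nq nr with hw₁
    set w₂ := IsThreeCut.addTriangleStar w A a p q r lp lq lr (np + lp + w q r) (nq + lq + w p r)
      (nr + lr + w p q) with hw₂
    have e1 : w₁ q r = w q r + np := by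
      simp [hw₁, IsThreeCut.addTriangle, parallelEdges, hpq.symm, hpr.symm, hqr]
    have e2 : w₁ p r = w p r + nq := by
      simp [hw₁, IsThreeCut.addTriangle, parallelEdges, hpq, hqr.symm, hpr]
    have e3 : w₁ p q = w p q + nr := by
      simp [hw₁, IsThreeCut.addTriangle, parallelEdges, hpq, hqr, hpr]
    have e4 : w₂ q r = w q r + lp := by
      simp [hw₂, IsThreeCut.addTriangleStar, parallelEdges, hpq.symm, hpr.symm, hqr, haq.symm,
        har.symm, h.qA, h.rA]
    have e5 : w₂ p r = w p r + lq := by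
      simp [hw₂, IsThreeCut.addTriangleStar, parallelEdges, hpq, hqr.symm, hpr, hap.symm,
        har.symm, h.pA, h.rA]
    have e6 : w₂ p q = w p q + lr := by
      simp [hw₂, IsThreeCut.addTriangleStar, parallelEdges, hpq, hqr, hpr, hap.symm,
        haq.symm, h.pA, h.qA]
    have e7 : w₂ p a = np + lp + w q r := by
      simp [hw₂, IsThreeCut.addTriangleStar, parallelEdges, hpq, hpr, haq, har, hap.symm, ha]
    have e8 : w₂ q a = nq + lq + w p r := by
      simp [hw₂, IsThreeCut.addTriangleStar, parallelEdges, hpq.symm, hqr, hap, har, haq.symm, ha]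
    have e9 : w₂ r a = nr + lr + w p q := by
      simp [hw₂, IsThreeCut.addTriangleStar, parallelEdges, hpr.symm, hqr.symm, hap, haq,
        har.symm, ha]
    clear_value w₁ w₂
    intro x y z hx
    have h1 := hs₁ y z
    have h2 := hs₂ y z
    rcases h.cover x hx.pA hx.pB with rfl | rfl | rfl <;>
      rcases h.cover y hx.qA hx.qB with rfl | rfl | rfl <;>
      rcases h.cover z hx.rA hx.rB with rfl | rfl | rfl <;>
      first
        | exact absurd rfl hx.pq
        | exact absurd rfl hx.pr
        | exact absurd rfl hx.qr
        | omega

end Reduction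

/-! ### Multiplicity functions of graphs -/

namespace Graph

section Multiplicity

variable {α ι : Type*} {β : Type*} {G : Graph α β} {φ : ι → α} {S : Finset ι}

/-- The number of edges of `G` between the vertices labelled `x` and `y`, where `φ` assigns to each
label a vertex. -/
noncomputable def multiplicity (G : Graph α β) (φ : ι → α) (x y : ι) : ℕ :=
  {e | G.IsLink e (φ x) (φ y)}.ncard

theorem multiplicity_comm (G : Graph α β) (φ : ι → α) (x y : ι) :
    G.multiplicity φ x y = G.multiplicity φ y x := by
  unfold multiplicity
  simp_rw [G.isLink_comm]

theorem multiplicity_self [G.Loopless] (φ : ι → α) (x : ι) : G.multiplicity φ x x = 0 := by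
  simp [multiplicity]

theorem finite_setOf_isLink (hE : E(G).Finite) (x y : α) : {e | G.IsLink e x y}.Finite :=
  hE.subset fun _ he => he.edge_mem

theorem exists_finset_image_eq {X : Set α} (hX : X ⊆ φ '' S) : ∃ Y ⊆ S, φ '' (Y : Set ι) = X := by
  classical
  refine ⟨S.filter (φ · ∈ X), filter_subset _ _, Set.ext fun v => ⟨?_, fun hv => ?_⟩⟩
  · rintro ⟨x, hx, rfl⟩
    simpa using (mem_filter.1 hx).2
  · obtain ⟨x, hx, rfl⟩ := hX hv
    exact ⟨x, by simpa using ⟨hx, hv⟩, rfl⟩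

variable [DecidableEq ι]

theorem ncard_setOf_exists_isLink (hφ : φ.Injective) (hE : E(G).Finite) (P : Finset (ι × ι))
    (hP : ∀ x y, (x, y) ∈ P → (y, x) ∉ P) :
    {e | ∃ p ∈ P, G.IsLink e (φ p.1) (φ p.2)}.ncard = ∑ p ∈ P, G.multiplicity φ p.1 p.2 := by
  induction P using Finset.induction_on with
  | empty => simp
  | insert p P hp ih =>
    rw [sum_insert hp, ← ih fun x y h h' => hP x y (mem_insert_of_mem h) (mem_insert_of_mem h'),
      multiplicity, ← Set.ncard_union_eq ?_ (finite_setOf_isLink hE _ _)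
        (hE.subset fun e (⟨_, _, he⟩ : ∃ p ∈ P, _) => he.edge_mem)]
    · congr 1
      ext e
      simp
    · refine Set.disjoint_left.2 fun e he he' => ?_
      obtain ⟨p', hp', he'⟩ := he'
      rcases he.eq_and_eq_or_eq_and_eq he' with ⟨h1, h2⟩ | ⟨h1, h2⟩
      · exact hp ((Prod.ext (hφ h1) (hφ h2) : p = p') ▸ hp')
      · refine hP p.1 p.2 (mem_insert_self _ _) (mem_insert_of_mem ?_)
        rwa [(Prod.ext (hφ h2) (hφ h1) : (p.2, p.1) = p')]

theorem ncard_edgeCut (hφ : φ.Injective) (hE : E(G).Finite) (hV : V(G) = φ '' S) (Y : Finset ι) :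
    (G.edgeCut (φ '' Y)).ncard = edgesBetween (G.multiplicity φ) Y (S \ Y) := by
  unfold edgesBetween
  rw [← sum_product' (f := fun x y => G.multiplicity φ x y), ← ncard_setOf_exists_isLink hφ hE]
  · congr 1
    ext e
    rw [edgeCut, hV, ← Set.image_sdiff hφ, ← coe_sdiff]
    simp [and_assoc]
  · intro x y h h'
    simp only [mem_product, mem_sdiff] at h h'
    exact h'.2.2 h.1

theorem degree_eq_sum (hφ : φ.Injective) (hE : E(G).Finite) [G.Loopless] (hV : V(G) = φ '' S)
    {x : ι} (hx : x ∈ S) : G.degree (φ x) = ∑ y ∈ S, G.multiplicity φ x y := by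
  rw [← add_sum_erase S _ hx, multiplicity_self, zero_add]
  have := ncard_setOf_exists_isLink hφ hE ({x} ×ˢ S.erase x) (by
    intro y z h h'
    simp only [mem_product, mem_singleton, mem_erase] at h h'
    exact h.2.1 h'.1)
  rw [sum_product' (f := fun x y => G.multiplicity φ x y), sum_singleton] at this
  rw [← this, degree]
  congr 1
  ext e
  simp only [mem_incidenceSet, Set.mem_ofPred_eq, mem_product, mem_singleton, mem_erase, Prod.exists]
  constructor
  · rintro ⟨y, he⟩
    obtain ⟨z, hz, rfl⟩ : y ∈ φ '' S := hV ▸ he.right_mem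
    exact ⟨x, z, ⟨rfl, fun h => he.ne (h ▸ rfl), hz⟩, he⟩
  · rintro ⟨_, z, ⟨rfl, -⟩, he⟩
    exact ⟨_, he⟩

theorem isFiveConnected_multiplicity_iff (hφ : φ.Injective) (hE : E(G).Finite) [G.Loopless]
    (hV : V(G) = φ '' S) :
    IsFiveConnected (G.multiplicity φ) S ↔ G.IsRegular 5 ∧ G.IsEdgeConnected 5 := by
  constructor
  · refine fun h => ⟨fun x hx => ?_, fun X hX hX0 => ?_⟩
    · rw [hV] at hx
      obtain ⟨x, hx, rfl⟩ := hx
      rw [degree_eq_sum hφ hE hV hx, h.regular x hx]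
    · obtain ⟨Y, hY, rfl⟩ := exists_finset_image_eq (hX.1.trans hV.le)
      rw [ncard_edgeCut hφ hE hV]
      exact h.conn Y hY (by simpa using hX0) fun h => hX.ne (by rw [hV, h])
  · refine fun ⟨h1, h2⟩ => ⟨G.multiplicity_comm φ, multiplicity_self φ, fun x hx => ?_,
      fun Y hYS hY hne => ?_⟩
    · rw [← degree_eq_sum hφ hE hV hx, h1 _ (hV ▸ Set.mem_image_of_mem φ hx)]
    · rw [← ncard_edgeCut hφ hE hV]
      refine h2 _ ?_ (by simpa using hY)
      rw [hV, Set.ssubset_iff_subset_ne]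
      exact ⟨Set.image_mono hYS, fun h => hne (by simpa using hφ.image_injective h)⟩

/-- An edge-connected regular graph of degree five is a `5`-graph: by parity its order is even, so
that every odd set of vertices is a proper subset. -/
theorem isRGraph_of_isFiveConnected (hφ : φ.Injective) (hE : E(G).Finite) [G.Loopless]
    (hV : V(G) = φ '' S) (h : IsFiveConnected (G.multiplicity φ) S) : G.IsRGraph 5 := by
  obtain ⟨hreg, hconn⟩ := (isFiveConnected_multiplicity_iff hφ hE hV).1 h
  refine ⟨hV ▸ S.finite_toSet.image φ, hE, inferInstance, hreg, fun X hX hodd => ?_⟩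
  refine hconn X (Set.ssubset_iff_subset_ne.2 ⟨hX, ?_⟩) (Set.nonempty_of_ncard_ne_zero ?_)
  · rintro rfl
    rw [hV, Set.ncard_image_of_injective _ hφ, Set.ncard_coe_finset] at hodd
    exact Nat.not_even_iff_odd.2 hodd h.even_card
  · intro h0
    simp [h0] at hodd

theorem isMatchingSum_of_hasPDPM (hφ : φ.Injective) (hE : E(G).Finite) [G.Loopless]
    (hV : V(G) = φ '' S) (hreg : G.IsRegular 5) (h : G.HasPDPM 5) :
    IsMatchingSum (Fin 5) (G.multiplicity φ) S := by
  obtain ⟨N, hN, hdisj⟩ := h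
  have hex : ∀ i x, ∃ y, x ∈ S → y ∈ S ∧ ∃ e ∈ N i, G.IsLink e (φ x) (φ y) := by
    intro i x
    by_cases hx : x ∈ S
    · obtain ⟨e, ⟨heN, y, he⟩, -⟩ := (hN i).2 (φ x) (hV ▸ Set.mem_image_of_mem φ hx)
      obtain ⟨y, hy, rfl⟩ : y ∈ φ '' S := hV ▸ he.right_mem
      exact ⟨y, fun _ => ⟨hy, e, heN, he⟩⟩
    · exact ⟨x, fun h => absurd h hx⟩
  choose f hf using hex
  refine ⟨f, fun i x hx => ?_, fun x hx => ?_⟩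
  · obtain ⟨h1, e, h2, h3⟩ := hf i x hx
    obtain ⟨h4, e', h5, h6⟩ := hf i _ h1
    refine ⟨h1, hφ ?_⟩
    have := ((hN i).2 (φ (f i x)) h3.right_mem).unique ⟨h2, h3.inc_right⟩ ⟨h5, h6.inc_left⟩
    rw [← this] at h6
    exact h6.right_unique h3.symm
  · -- Disjoint matchings use different edges at `x`, and equality follows by adding up the degrees.
    choose e heN he using fun i => (hf i x hx).2
    have hle : ∀ y ∈ S, #{i | f i x = y} ≤ G.multiplicity φ x y := by
      intro y _
      rw [← Set.ncard_coe_finset, multiplicity]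
      refine Set.ncard_le_ncard_of_injOn (e) (fun i hi => ?_) (fun i _ j _ hij => ?_)
        (finite_setOf_isLink hE _ _)
      · simp only [coe_filter, mem_univ, true_and, Set.mem_ofPred_eq] at hi ⊢
        exact hi ▸ he i
      · by_contra hne
        exact Set.disjoint_left.1 (hdisj i j hne) (heN i) (hij ▸ heN j)
    refine (sum_eq_sum_iff_of_le hle).1 ?_
    rw [← degree_eq_sum hφ hE hV hx, hreg _ (hV ▸ Set.mem_image_of_mem φ hx),
      ← card_eq_sum_card_fiberwise fun i _ => (hf i x hx).1]
    simp

theorem hasPDPM_of_isMatchingSum (hφ : φ.Injective) (hE : E(G).Finite) [G.Loopless]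
    (hV : V(G) = φ '' S) (h : IsMatchingSum (Fin 5) (G.multiplicity φ) S) : G.HasPDPM 5 := by
  obtain ⟨f, hf, hc⟩ := h
  obtain rfl | ⟨x₀, hx₀⟩ := S.eq_empty_or_nonempty
  · exact ⟨fun _ => ∅, fun _ => ⟨Set.empty_subset _, by simp [hV]⟩, fun _ _ _ => disjoint_bot_left⟩
  have hinj : ∀ x ∈ S, ∀ y ∈ S, ∃ ψ : {i // f i x = y} → β, ψ.Injective ∧
      ∀ i, G.IsLink (ψ i) (φ x) (φ y) := by
    intro x hx y hy
    have := (finite_setOf_isLink hE (φ x) (φ y)).fintype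
    obtain ⟨e⟩ : Nonempty ({i // f i x = y} ↪ {e | G.IsLink e (φ x) (φ y)}) :=
      Function.Embedding.nonempty_of_card_le (by
        rw [Fintype.card_subtype, hc x hx y hy, multiplicity, Set.ncard_eq_toFinset_card',
          Set.toFinset_card])
    exact ⟨fun i => e i, Subtype.val_injective.comp e.injective, fun i => (e i).2⟩
  have hβ : Nonempty β := by
    obtain ⟨ψ, -, -⟩ := hinj x₀ hx₀ _ (hf 0 x₀ hx₀).1
    exact ⟨ψ ⟨0, rfl⟩⟩
  -- For each pair of vertices the matchings that contain this pair receive different edges.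
  have hex : ∀ s : Sym2 ι, ∃ ψ : Fin 5 → β, ∀ x ∈ S, ∀ i, s = s(x, f i x) →
      G.IsLink (ψ i) (φ x) (φ (f i x)) ∧ ∀ j, f j x = f i x → ψ j = ψ i → j = i := by
    intro s
    by_cases hs : ∃ x ∈ S, ∃ i, s = s(x, f i x)
    · obtain ⟨x, hx, i, rfl⟩ := hs
      obtain ⟨ψ, hψ, hl⟩ := hinj x hx _ (hf i x hx).1
      refine ⟨fun j => if h : f j x = f i x then ψ ⟨j, h⟩ else hβ.some, fun y hy j he => ?_⟩
      rcases Sym2.eq_iff.1 he with ⟨rfl, h2⟩ | ⟨h1, h2⟩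
      · refine ⟨?_, fun k hk hkj => ?_⟩
        · simp only [h2.symm, dif_pos]
          exact hl _
        · rw [← h2] at hk
          simp only [hk, h2.symm, dif_pos] at hkj
          exact congrArg Subtype.val (hψ hkj)
      · have h3 : f j x = f i x := by rw [h2, h1, (hf j y hy).2]
        refine ⟨?_, fun k hk hkj => ?_⟩
        · simp only [h3, dif_pos]
          rw [← h1, ← h2]
          exact (hl _).symm
        · have h4 : f k x = f i x := by rw [h2, h1, ← hk, (hf k y hy).2]
          simp only [h3, h4, dif_pos] at hkj
          exact congrArg Subtype.val (hψ hkj)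
    · push Not at hs
      exact ⟨fun _ => hβ.some, fun x hx i he => absurd he (hs x hx i)⟩
  choose ψ hψ using hex
  have hlink : ∀ i, ∀ x ∈ S, G.IsLink (ψ s(x, f i x) i) (φ x) (φ (f i x)) := fun i x hx =>
    (hψ _ x hx i rfl).1
  refine ⟨fun i => {e | ∃ x ∈ S, e = ψ s(x, f i x) i}, fun i => ⟨?_, ?_⟩, fun i j hij => ?_⟩
  · rintro _ ⟨x, hx, rfl⟩
    exact (hlink i x hx).edge_mem
  · intro v hv
    obtain ⟨x, hx, rfl⟩ : v ∈ φ '' S := hV ▸ hv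
    refine ⟨_, ⟨⟨x, hx, rfl⟩, (hlink i x hx).inc_left⟩, ?_⟩
    rintro _ ⟨⟨y, hy, rfl⟩, hinc⟩
    rcases hinc.eq_or_eq_of_isLink (hlink i y hy) with h1 | h1
    · rw [hφ h1]
    · rw [hφ h1, (hf i y hy).2, Sym2.eq_swap]
  · refine Set.disjoint_left.2 ?_
    rintro _ ⟨x, hx, rfl⟩ ⟨y, hy, he⟩
    have h1 := hlink i x hx
    rw [he] at h1
    have h2 : s(x, f i x) = s(y, f j y) := by
      rcases h1.eq_and_eq_or_eq_and_eq (hlink j y hy) with ⟨h2, h3⟩ | ⟨h2, h3⟩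
      · rw [hφ h2, ← hφ h3, hφ h2]
      · rw [hφ h3, hφ h2, Sym2.eq_swap]
    rw [h2] at he
    refine hij ((hψ _ y hy j rfl).2 i ?_ he)
    rcases Sym2.eq_iff.1 h2 with ⟨rfl, h3⟩ | ⟨h3, h4⟩
    · exact h3
    · exact (congrArg (f i) h4.symm).trans ((hf i x hx).2.trans h3)

end Multiplicity

end Graph

/-! ### Graphs with given multiplicities, and the reduction to multiplicity functions -/

namespace Graph

/-- The multigraph on `S` with multiplicity function `w`. Its edges are the pairs `(s, t)` where `s`
is an unordered pair of vertices and `t` is less than the multiplicity of `s`; the vertices are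
numbered by `e` so that the type of edges can be placed in any universe. -/
def ofMultiplicity {V : Type u} (w : V → V → ℕ) (hw : ∀ x y, w x y = w y x) (S : Finset V) {n : ℕ}
    (e : V ≃ Fin n) : Graph V (ULift.{v} (Sym2 (Fin n) × ℕ)) where
  vertexSet := S
  IsLink ε x y := x ∈ S ∧ y ∈ S ∧ ε.down.1 = s(e x, e y) ∧ ε.down.2 < w x y
  isLink_symm ε _ := ⟨fun x y ⟨h1, h2, h3, h4⟩ => ⟨h2, h1, by rw [h3, Sym2.eq_swap], hw x y ▸ h4⟩⟩
  eq_or_eq_of_isLink_of_isLink ε x y z t h h' := by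
    have := h.2.2.1.symm.trans h'.2.2.1
    rw [Sym2.eq_iff] at this
    simp only [e.injective.eq_iff] at this
    tauto
  left_mem_of_isLink _ _ _ h := h.1

section Realization

variable {V : Type u} {w : V → V → ℕ} {hw : ∀ x y, w x y = w y x} {S : Finset V} {n : ℕ}
  {e : V ≃ Fin n}

theorem multiplicity_ofMultiplicity {x y : V} (hx : x ∈ S) (hy : y ∈ S) :
    (ofMultiplicity.{u, v} w hw S e).multiplicity id x y = w x y := by
  have : {ε | (ofMultiplicity.{u, v} w hw S e).IsLink ε (id x) (id y)} =
      (fun t => ULift.up (s(e x, e y), t)) '' (range (w x y) : Set ℕ) := by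
    ext ⟨s, t⟩
    simp only [ofMultiplicity, id, hx, hy, true_and, Set.mem_ofPred_eq, Set.mem_image, coe_range,
      Set.mem_Iio, ULift.up.injEq, Prod.mk.injEq]
    constructor
    · rintro ⟨rfl, h⟩
      exact ⟨t, h, rfl, rfl⟩
    · rintro ⟨t, h, rfl, rfl⟩
      exact ⟨rfl, h⟩
  rw [multiplicity, this, Set.ncard_image_of_injective _ fun t t' h => by simpa using h,
    Set.ncard_coe_finset, card_range]

theorem finite_edgeSet_ofMultiplicity : E(ofMultiplicity.{u, v} w hw S e).Finite := by
  have : E(ofMultiplicity.{u, v} w hw S e) ⊆ ⋃ x ∈ S, ⋃ y ∈ S,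
      (fun t => ULift.up (s(e x, e y), t)) '' (range (w x y) : Set ℕ) := by
    rintro ⟨s, t⟩ ⟨x, y, hx, hy, hs, ht⟩
    simp only [Set.mem_iUnion]
    exact ⟨x, hx, y, hy, t, by simpa using ht, by rw [← hs]⟩
  refine Set.Finite.subset ?_ this
  exact S.finite_toSet.biUnion fun x _ => S.finite_toSet.biUnion fun y _ =>
    (finite_toSet _).image _

theorem loopless_ofMultiplicity (h0 : ∀ x, w x x = 0) :
    (ofMultiplicity.{u, v} w hw S e).Loopless where
  not_isLoopAt _ x h := by
    have h1 := h.2.2.2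
    rw [h0] at h1
    exact Nat.not_lt_zero _ h1

end Realization

/-- The multiplicities of a smallest class 2 graph form a minimal counterexample, since every
multiplicity function is realized by a graph. -/
theorem isMinimalCounterexample_multiplicity {α : Type u} {β : Type v} {G : Graph α β}
    (hG : G.IsRGraph 5) (hconn : G.IsEdgeConnected 5) (hclass : G.IsClassTwo 5)
    (hmin : ∀ (α' : Type u) (β' : Type v) (H : Graph α' β'),
      H.IsRGraph 5 → H.IsEdgeConnected 5 → H.IsClassTwo 5 → V(G).ncard ≤ V(H).ncard)
    [DecidableEq V(G)] [Fintype V(G)] :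
    IsMinimalCounterexample (G.multiplicity ((↑) : V(G) → α)) := by
  have := hG.loopless
  have hφ : ((↑) : V(G) → α).Injective := Subtype.val_injective
  have hV : V(G) = ((↑) : V(G) → α) '' (univ : Finset V(G)) := by simp
  have hE := hG.finite_edgeSet
  refine ⟨(isFiveConnected_multiplicity_iff hφ hE hV).2 ⟨hG.regular, hconn⟩,
    fun h => hclass.2 (hasPDPM_of_isMatchingSum hφ hE hV h), fun w S hw hS => ?_⟩
  by_contra hn
  let H := ofMultiplicity.{u, v} w hw.symm S (Fintype.equivFin V(G))
  have : H.Loopless := loopless_ofMultiplicity hw.loopless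
  have hVH : V(H) = id '' (S : Set V(G)) := by simp [H, ofMultiplicity]
  have hEH : E(H).Finite := finite_edgeSet_ofMultiplicity
  have hmul : ∀ x ∈ S, ∀ y ∈ S, H.multiplicity id x y = w x y := fun x hx y hy =>
    multiplicity_ofMultiplicity hx hy
  have hH := hw.congr (H.multiplicity_comm id) (multiplicity_self id) hmul
  obtain ⟨h1, h2⟩ := (isFiveConnected_multiplicity_iff Function.injective_id hEH hVH).1 hH
  have h3 := hmin _ _ H (isRGraph_of_isFiveConnected Function.injective_id hEH hVH hH) h2
    ⟨h1, fun h => hn ((isMatchingSum_of_hasPDPM Function.injective_id hEH hVH h1 h).congr hmul)⟩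
  rw [hVH, Set.image_id, Set.ncard_coe_finset, ← Nat.card_coe_set_eq, Nat.card_eq_fintype_card] at h3
  exact absurd hS h3.not_gt

end Graph

theorem mainTheorem8 {α : Type u} {β : Type v} (G : Graph α β)
    (hG : G.IsRGraph 5) (hconn : G.IsEdgeConnected 5) (hclass : G.IsClassTwo 5)
    (hmin : ∀ (α' : Type u) (β' : Type v) (H : Graph α' β'),
      H.IsRGraph 5 → H.IsEdgeConnected 5 → H.IsClassTwo 5 → V(G).ncard ≤ V(H).ncard) :
    (∀ X : Set α, X ⊆ V(G) → (G.edgeCut X).ncard = 5 →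
      X.ncard = 1 ∨ (V(G) \ X).ncard = 1) ∧
    (∀ X : Set α, X ⊆ V(G) → X.ncard = 3 →
      ¬ (G.deleteVerts X).toSimpleGraph.Connected →
      ∃ C : (G.deleteVerts X).toSimpleGraph.ConnectedComponent, C.supp.ncard = 1) := by
  classical
  have := hG.finite_vertexSet.fintype
  have := hG.loopless
  have hw := G.isMinimalCounterexample_multiplicity hG hconn hclass hmin
  have hφ : ((↑) : V(G) → α).Injective := Subtype.val_injective
  have hV : V(G) = ((↑) : V(G) → α) '' (univ : Finset V(G)) := by simp
  have hE := hG.finite_edgeSet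
  refine ⟨fun X hX hcut => ?_, fun X hX hcard hdis => ?_⟩
  · obtain ⟨Y, -, rfl⟩ := Graph.exists_finset_image_eq (hX.trans hV.le)
    rw [Graph.ncard_edgeCut hφ hE hV, ← compl_eq_univ_sdiff] at hcut
    have h := hw.card_eq_one_of_cut_eq_five hcut
    have hc : V(G) \ ((↑) '' (Y : Set V(G))) = ((↑) : V(G) → α) '' (Yᶜ : Finset V(G)) := by
      rw [coe_compl, Set.compl_eq_univ_sdiff, Set.image_sdiff hφ]
      simp
    rwa [hc, Set.ncard_image_of_injective _ hφ, Set.ncard_image_of_injective _ hφ,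
      Set.ncard_coe_finset, Set.ncard_coe_finset]
  · obtain ⟨Y, -, rfl⟩ := Graph.exists_finset_image_eq (hX.trans hV.le)
    rw [Set.ncard_image_of_injective _ hφ, Set.ncard_coe_finset, card_eq_three] at hcard
    obtain ⟨p, q, r, hpq, hpr, hqr, rfl⟩ := hcard
    set X : Set α := (↑) '' ((({p, q, r} : Finset V(G)) : Set V(G))) with hXdef
    have hmemX : ∀ x : V(G), (x : α) ∈ X ↔ x = p ∨ x = q ∨ x = r := by
      intro x
      rw [hXdef, hφ.mem_set_image]
      simp
    have hVD : ∀ x : V(G), (x : α) ∈ V(G.deleteVerts X) ↔ (x : α) ∉ X := fun x => by simp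
    -- `side P` is the union of the components satisfying `P`; the separation used in the end is
    -- that of one component from all others.
    obtain ⟨side, hside⟩ : ∃ side :
        ((G.deleteVerts X).toSimpleGraph.ConnectedComponent → Prop) → Finset V(G),
        ∀ P x, x ∈ side P ↔ ∃ h : (x : α) ∈ V(G.deleteVerts X),
          P ((G.deleteVerts X).toSimpleGraph.connectedComponentMk ⟨x, h⟩) :=
      ⟨fun P => univ.filter fun x => ∃ h : (x : α) ∈ V(G.deleteVerts X),
        P ((G.deleteVerts X).toSimpleGraph.connectedComponentMk ⟨x, h⟩), fun P x => by simp⟩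
    have hcut : ∀ P, IsThreeCut (G.multiplicity ((↑) : V(G) → α)) (side P) (side fun C => ¬ P C)
        p q r := by
      intro P
      have hX : ∀ x : V(G), (x : α) ∈ X → ∀ P, x ∉ side P := fun x hx P h =>
        (hVD x).1 ((hside P x).1 h).1 hx
      have hp := hX p ((hmemX p).2 (by simp))
      have hq := hX q ((hmemX q).2 (by simp))
      have hr := hX r ((hmemX r).2 (by simp))
      refine ⟨hpq, hpr, hqr, disjoint_left.2 fun x hx hx' => ?_, hp _, hq _, hr _, hp _, hq _, hr _,
        fun x h1 h2 => ?_, fun x hx y hy => ?_⟩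
      · exact ((hside _ x).1 hx').2 ((hside _ x).1 hx).2
      · rw [← hmemX]
        by_contra hx
        by_cases hP : P ((G.deleteVerts X).toSimpleGraph.connectedComponentMk ⟨x, (hVD x).2 hx⟩)
        · exact h1 ((hside _ x).2 ⟨_, hP⟩)
        · exact h2 ((hside _ x).2 ⟨_, hP⟩)
      · obtain ⟨hx1, hx2⟩ := (hside _ x).1 hx
        obtain ⟨hy1, hy2⟩ := (hside _ y).1 hy
        rw [Graph.multiplicity, Set.ncard_eq_zero (Graph.finite_setOf_isLink hE _ _)]
        refine Set.eq_empty_of_forall_notMem fun e he => hy2 ?_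
        have hadj : (G.deleteVerts X).toSimpleGraph.Adj ⟨x, hx1⟩ ⟨y, hy1⟩ := by
          rw [Graph.toSimpleGraph_adj]
          refine ⟨fun h => he.ne (Subtype.mk.inj h), e, ?_⟩
          rw [Graph.deleteVerts_isLink]
          exact ⟨he, (hVD x).1 hx1, (hVD y).1 hy1⟩
        rwa [← SimpleGraph.ConnectedComponent.sound hadj.reachable]
    have hcardV : ∀ P, Even (#(side P) + #(side fun C => ¬ P C) + 3) := by
      intro P
      have h1 := hw.fiveConnected.even_card
      have h2 := (hcut P).sum_univ (fun _ => 1)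
      simp only [sum_const, smul_eq_mul, mul_one] at h2
      rwa [h2] at h1
    -- A side consisting of a single vertex is a component.
    have hsingle : ∀ P, #(side P) = 1 →
        ∃ C : (G.deleteVerts X).toSimpleGraph.ConnectedComponent, C.supp.ncard = 1 := by
      intro P hP
      obtain ⟨x, hx⟩ := card_eq_one.1 hP
      obtain ⟨h1, h2⟩ := (hside P x).1 (hx ▸ mem_singleton_self x)
      refine ⟨(G.deleteVerts X).toSimpleGraph.connectedComponentMk ⟨x, h1⟩,
        Set.ncard_eq_one.2 ⟨⟨x, h1⟩, Set.eq_singleton_iff_unique_mem.2 ⟨rfl, fun y hy => ?_⟩⟩⟩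
      have hyV : (y : α) ∈ V(G) := ((G.vertexSet_deleteVerts X).subset y.2).1
      have h3 : (⟨y, hyV⟩ : V(G)) ∈ side P := (hside P _).2 ⟨y.2, by
        rw [SimpleGraph.ConnectedComponent.mem_supp_iff] at hy
        exact hy ▸ h2⟩
      rw [hx, mem_singleton] at h3
      exact Subtype.ext (congrArg (fun z : V(G) => (z : α)) h3)
    have hnonempty : ∀ P C, P C → (side P).Nonempty := by
      intro P C
      induction C using SimpleGraph.ConnectedComponent.ind with
      | h y =>
        intro hy
        exact ⟨⟨y, ((G.vertexSet_deleteVerts X).subset y.2).1⟩, (hside P _).2 ⟨y.2, hy⟩⟩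
    obtain ⟨C, D, hCD⟩ : ∃ C D : (G.deleteVerts X).toSimpleGraph.ConnectedComponent, D ≠ C := by
      by_contra! hall
      refine hdis ((SimpleGraph.connected_iff _).2
        ⟨fun x y => SimpleGraph.ConnectedComponent.exact (hall _ _), ?_⟩)
      by_contra hemp
      have h0 : ∀ P, side P = ∅ := fun P => eq_empty_of_forall_notMem fun x hx =>
        hemp ⟨⟨x, ((hside P x).1 hx).1⟩⟩
      have := hcardV fun _ => True
      rw [h0, h0, card_empty] at this
      exact absurd this (by decide)
    have hC := hnonempty (· = C) C rfl
    have hD := hnonempty (fun E => ¬ E = C) D hCD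
    rcases Nat.even_or_odd #(side (· = C)) with heven | hodd
    · refine hsingle _ (hw.card_eq_one_of_isThreeCut
        ((hcut (· = C)).swap_sides hw.fiveConnected.symm) ?_ hC)
      have h1 := hcardV (· = C)
      rw [Nat.even_add, Nat.even_add] at h1
      rw [← Nat.not_even_iff_odd]
      exact fun h2 => absurd (h1.1 (iff_of_true heven h2)) (by decide)
    · exact hsingle _ (hw.card_eq_one_of_isThreeCut (hcut (· = C)) hodd hD)
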